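/- Setting. Fix a propositional language $\mathcal L$: a set of atoms, and connectives of finite arity, among which there may be a unary connective $\Box$. Formulas of $\mathcal L$ (formula schemes) representing the connectives $\wedge,\vee,\to,*$ (with two arguments) and $\top,\bot,0,1$ (with none) are fixed; these may be connectives of $\mathcal L$ or be defined from others, e.g. $\varphi*\psi:=\varphi\wedge\psi$, $1:=\top$, $0:=\bot$. $V(\varphi)$ is the set of variables of $\varphi$, and $\varphi$ is $p$-free if $p\notin V(\varphi)$. A sequent is an expression $\Gamma\Rightarrow\Delta$ with $\Gamma,\Delta$ finite multisets of formulas and $|\Delta|\le 1$. Meta-formulas are built with the connectives from atoms and formula symbols, and $V$ of a meta-formula is the set of formula symbols and atoms occurring in it; contexts are variables for multisets. A rule consists of finitely many premises and a conclusion, which are sequents of meta-formulas and contexts; its instances arise by substituting formulas for formula symbols and multisets of formulas for contexts so that all succedents have at most one element. A calculus is a set of rules, and derivability is by trees of rule instances. Below, Greek letters with bars are multisets of meta-formulas, and $\Pi_j,\Gamma_i,\Delta_i,\Gamma,\Delta$ are pairwise distinct contexts. A rule is semi-analytic if it is - left semi-analytic: from $\Pi_j,\bar\psi_{js}\Rightarrow\bar\theta_{js}$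 (all $j,s$) and $\Gamma_i,\bar\varphi_{ir}\Rightarrow\Delta_i$ (all $i,r$) infer $\Pi_1,\dots,\Pi_m,\Gamma_1,\dots,\Gamma_n,\varphi\Rightarrow\Delta_1,\dots,\Delta_n$, where $n\ge1$; or - right semi-analytic: from $\Gamma_i,\bar\varphi_{ir}\Rightarrow\bar\psi_{ir}$ (all $i,r$) infer $\Gamma_1,\dots,\Gamma_n\Rightarrow\varphi$; or - a modal rule: $(K)$ from $\Gamma\Rightarrow x$ infer $\Box\Gamma\Rightarrow\Box x$, with $x$ a formula symbol, or $(D)$ from $\Gamma\Rightarrow$ infer $\Box\Gamma\Rightarrow$. It is context-sharing semi-analytic if it has the form: from $\Gamma_i,\bar\psi_{is}\Rightarrow\bar\theta_{is}$ (all $i,s$) and $\Gamma_i,\bar\varphi_{ir}\Rightarrow\Delta_i$ (all $i,r$) infer $\Gamma_1,\dots,\Gamma_n,\varphi\Rightarrow\Delta_1,\dots,\Delta_n$, where $n\ge1$. In the left, right and context-sharing rules every variable of a meta-formula of a premise must be in $V(\varphi)$. The focused axioms are the premise-free rules with a conclusion of one of the forms $\varphi\Rightarrow\varphi$; $\ \Rightarrow\bar\alpha$;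 $\ \bar\beta\Rightarrow$; $\ \Gamma,\bar\varphi\Rightarrow\Delta$; $\ \Gamma\Rightarrow\bar\varphi,\Delta$, where any two members of $\bar\alpha$, of $\bar\beta$ and of $\bar\varphi$ have the same $V$. A calculus is terminating if for each sequent $S$ only finitely many of its rules have an instance with conclusion $S$, and there is a well-founded order on sequents in which the following lie below $S$: the premises of every rule instance with conclusion $S$; the proper subsequents of $S$; and, if $S=(\Gamma,\Box\Pi\Rightarrow\Delta,\Box\Lambda)$ with $\Pi,\Lambda$ not both empty, the sequent $\Gamma,\Pi\Rightarrow\Delta,\Lambda$. A logic is a set $L$ of formulas closed under modus ponens; $L\vdash A$ means $A\in L$. $H$ is a calculus for $L$ if for all sequents, $H$ derives $\Gamma\Rightarrow\Delta$ iff $L\vdash\circledast\Gamma\to\Delta$, where $\circledast\Gamma$ is the fusion of the members of $\Gamma$ in any order (the empty fusion is $1$) and an empty $\Delta$ is read as $0$. $\mathbf{IPC}$ is the set of formulas $A$ of $\mathcal L$ such that $\Rightarrow A$ is derivable in the single-conclusion sequent calculus $\mathbf{FL_e}$ with weakening and contraction. Theorem. Let $L$ be a logic with $\mathbf{IPC}\subseteq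 L$, and let $H$ be a terminating calculus for $L$ that consists of focused axioms, semi-analytic rules and context-sharing semi-analytic rules, where $(D)$ may be present only if $(K)$ is. Then: (a) $H$ has weak $H$-uniform interpolation: for every atom $p$ there are $p$-free formulas $I(S)$, for every sequent $S$, and $J(T)$, for every sequent $T$ with empty succedent, such that 1. if $S=(\Sigma\Rightarrow\Lambda)$, then $H$ derives $\Sigma,I(S)\Rightarrow\Lambda$; 2. if $S=(\Sigma\Rightarrow\Lambda)$ and $H$ derives $\Sigma,\Gamma\Rightarrow\Lambda$ with $\Gamma$ $p$-free, then $H$ derives $J(\Sigma\Rightarrow),\Gamma\Rightarrow I(S)$; 3. if $T=(\Sigma\Rightarrow)$, then $H$ derives $\Sigma\Rightarrow J(T)$; 4. if $T=(\Sigma\Rightarrow)$ and $H$ derives $\Sigma,\Gamma\Rightarrow\Delta$ with $\Gamma,\Delta$ $p$-free, then $H$ derives $J(T),\Gamma\Rightarrow\Delta$. (b) $L$ has uniform interpolation: for every formula $\varphi$ and atom $p$ there are $p$-free formulas $\forall p\,\varphi$ and $\exists p\,\varphi$ such that $L\vdash\forall p\,\varphi\to\varphi$ and $L\vdash\varphi\to\exists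 p\,\varphi$, and for every $p$-free $\psi$: if $L\vdash\psi\to\varphi$ then $L\vdash\psi\to\forall p\,\varphi$, and if $L\vdash\varphi\to\psi$ then $L\vdash\exists p\,\varphi\to\psi$. -/

import Mathlib

namespace SemiAnalytic

universe u v w

/-! ### Languages and formulas -/

/-- A propositional language: a type of connectives with finite arities. The language is modal if
one of its unary connectives is singled out as the box. -/
structure Signature where
  Conn : Type u
  arity : Conn → ℕ
  box : Option {c : Conn // arity c = 1}

/-- Formulas with atoms from `α`. -/
inductive Formula (L : Signature.{u}) (α : Type v) : Type (max u v)
  | atom (a : α) : Formula L α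
  | conn (c : L.Conn) (args : Fin (L.arity c) → Formula L α) : Formula L α

namespace Formula

variable {L : Signature.{u}} {α : Type v} {β : Type w}

/-- The set `V(φ)` of atoms occurring in a formula. -/
def vars : Formula L α → Set α
  | atom a => {a}
  | conn _ args => ⋃ i, (args i).vars

/-- `φ` is `p`-free: the atom `p` does not occur in `φ`. -/
def Free (p : α) (φ : Formula L α) : Prop := p ∉ φ.vars

/-- Simultaneous substitution of formulas for atoms. -/
def subst (f : α → Formula L β) : Formula L α → Formula L β
  | atom a => f a
  | conn c args => conn c (fun i => (args i).subst f)

/-- A unary connective applied to a formula. -/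
def unary (b : {c : L.Conn // L.arity c = 1}) (φ : Formula L α) : Formula L α :=
  conn b.1 (fun _ => φ)

end Formula

/-- A translation of the connectives `∧, ∨, →, ∗, ⊤, ⊥, 0, 1` into the language: every connective
is given by a formula scheme of the language. If the language has the connective itself, the
scheme can be that connective applied to distinct variables; in the language of intuitionistic
logic one can take `φ ∗ ψ := φ ∧ ψ`, `1 := ⊤`, `0 := ⊥`. -/
structure Translation (L : Signature.{u}) where
  andT : Formula L (Fin 2)
  orT : Formula L (Fin 2)
  impT : Formula L (Fin 2)
  fusT : Formula L (Fin 2)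
  topT : Formula L (Fin 0)
  botT : Formula L (Fin 0)
  zeroT : Formula L (Fin 0)
  oneT : Formula L (Fin 0)

namespace Translation

variable {L : Signature.{u}} (t : Translation L) {α : Type v}

def and (φ ψ : Formula L α) : Formula L α := t.andT.subst ![φ, ψ]
def or (φ ψ : Formula L α) : Formula L α := t.orT.subst ![φ, ψ]
def imp (φ ψ : Formula L α) : Formula L α := t.impT.subst ![φ, ψ]
def fus (φ ψ : Formula L α) : Formula L α := t.fusT.subst ![φ, ψ]
def top : Formula L α := t.topT.subst ![]
def bot : Formula L α := t.botT.subst ![]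
def zero : Formula L α := t.zeroT.subst ![]
def one : Formula L α := t.oneT.subst ![]

/-- The fusion `A₁ ∗ ⋯ ∗ Aₙ` of a list of formulas; the empty fusion is `1`. -/
def fusion : List (Formula L α) → Formula L α
  | [] => t.one
  | [A] => A
  | A :: B :: l => t.fus A (fusion (B :: l))

end Translation

/-! ### Sequents -/

/-- A sequent `ant ⇒ suc` of finite multisets of formulas. -/
@[ext]
structure Sequent (L : Signature.{u}) (α : Type v) where
  ant : Multiset (Formula L α)
  suc : Multiset (Formula L α)

namespace Sequent

variable {L : Signature.{u}} {α : Type v}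

/-- Single-conclusion sequents. -/
def Single (S : Sequent L α) : Prop := S.suc.card ≤ 1

/-- Proper subsequents. -/
def IsProperSub (S' S : Sequent L α) : Prop :=
  S'.ant ≤ S.ant ∧ S'.suc ≤ S.suc ∧ S' ≠ S

/-- The product `S · T`. -/
def mul (S T : Sequent L α) : Sequent L α := ⟨S.ant + T.ant, S.suc + T.suc⟩

end Sequent

/-! ### Intuitionistic logic -/

/-- The single-conclusion calculus for intuitionistic propositional logic, i.e. `FLₑ` with
weakening and contraction, over all formulas of the language. In every derivable sequent the
succedent has at most one element. -/
inductive IPCDerivable {L : Signature.{u}} {α : Type v} (t : Translation L) :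
    Multiset (Formula L α) → Multiset (Formula L α) → Prop
  | id (φ) : IPCDerivable t {φ} {φ}
  | top (Γ) : IPCDerivable t Γ {t.top}
  | bot (Γ Δ) : Δ.card ≤ 1 → IPCDerivable t (t.bot ::ₘ Γ) Δ
  | one : IPCDerivable t 0 {t.one}
  | zero : IPCDerivable t {t.zero} 0
  | oneL (Γ Δ) : IPCDerivable t Γ Δ → IPCDerivable t (t.one ::ₘ Γ) Δ
  | zeroR (Γ) : IPCDerivable t Γ 0 → IPCDerivable t Γ {t.zero}
  | andL₁ (Γ Δ φ ψ) : IPCDerivable t (φ ::ₘ Γ) Δ → IPCDerivable t (t.and φ ψ ::ₘ Γ) Δ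
  | andL₂ (Γ Δ φ ψ) : IPCDerivable t (ψ ::ₘ Γ) Δ → IPCDerivable t (t.and φ ψ ::ₘ Γ) Δ
  | andR (Γ φ ψ) : IPCDerivable t Γ {φ} → IPCDerivable t Γ {ψ} → IPCDerivable t Γ {t.and φ ψ}
  | orL (Γ Δ φ ψ) : IPCDerivable t (φ ::ₘ Γ) Δ → IPCDerivable t (ψ ::ₘ Γ) Δ →
      IPCDerivable t (t.or φ ψ ::ₘ Γ) Δ
  | orR₁ (Γ φ ψ) : IPCDerivable t Γ {φ} → IPCDerivable t Γ {t.or φ ψ}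
  | orR₂ (Γ φ ψ) : IPCDerivable t Γ {ψ} → IPCDerivable t Γ {t.or φ ψ}
  | fusL (Γ Δ φ ψ) : IPCDerivable t (φ ::ₘ ψ ::ₘ Γ) Δ → IPCDerivable t (t.fus φ ψ ::ₘ Γ) Δ
  | fusR (Γ Γ' φ ψ) : IPCDerivable t Γ {φ} → IPCDerivable t Γ' {ψ} →
      IPCDerivable t (Γ + Γ') {t.fus φ ψ}
  | impL (Γ Γ' Δ φ ψ) : IPCDerivable t Γ {φ} → IPCDerivable t (ψ ::ₘ Γ') Δ →
      IPCDerivable t (t.imp φ ψ ::ₘ (Γ + Γ')) Δ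
  | impR (Γ φ ψ) : IPCDerivable t (φ ::ₘ Γ) {ψ} → IPCDerivable t Γ {t.imp φ ψ}
  | weakL (Γ Δ φ) : IPCDerivable t Γ Δ → IPCDerivable t (φ ::ₘ Γ) Δ
  | weakR (Γ φ) : IPCDerivable t Γ 0 → IPCDerivable t Γ {φ}
  | contrL (Γ Δ φ) : IPCDerivable t (φ ::ₘ φ ::ₘ Γ) Δ → IPCDerivable t (φ ::ₘ Γ) Δ

/-- The theorems of intuitionistic propositional logic in the given language. -/
def IPC {L : Signature.{u}} (t : Translation L) (α : Type v) : Set (Formula L α) :=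
  {A | IPCDerivable t 0 {A}}

/-- A logic: a set of formulas (its theorems) closed under modus ponens. -/
structure Logic {L : Signature.{u}} (t : Translation L) (α : Type v) where
  thms : Set (Formula L α)
  mp : ∀ A B, t.imp A B ∈ thms → A ∈ thms → B ∈ thms

/-- The uniform interpolation property of a logic. -/
def Logic.HasUniformInterpolation {L : Signature.{u}} {t : Translation L} {α : Type v}
    (Λ : Logic t α) : Prop :=
  ∀ (φ : Formula L α) (p : α), ∃ pre post : Formula L α,
    pre.Free p ∧ post.Free p ∧
    t.imp pre φ ∈ Λ.thms ∧
    (∀ ψ : Formula L α, ψ.Free p → t.imp ψ φ ∈ Λ.thms → t.imp ψ pre ∈ Λ.thms) ∧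
    t.imp φ post ∈ Λ.thms ∧
    (∀ ψ : Formula L α, ψ.Free p → t.imp φ ψ ∈ Λ.thms → t.imp post ψ ∈ Λ.thms)

/-! ### Meta-language and rules -/

/-- Meta-formulas are built from formula symbols (`Sum.inl n`) and atoms (`Sum.inr a`). The
variables of a meta-formula, `Formula.vars`, are the formula symbols and atoms in it. -/
abbrev MetaFormula (L : Signature.{u}) (α : Type v) := Formula L (ℕ ⊕ α)

/-- The formula that results from a meta-formula when its formula symbols are replaced. -/
def MetaFormula.inst {L : Signature.{u}} {α : Type v} (σ : ℕ → Formula L α)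
    (φ : MetaFormula L α) : Formula L α :=
  Formula.subst (Sum.elim σ Formula.atom) φ

/-- A meta-multiset: a finite multiset of meta-formulas, of meta-multiset variables (contexts) `Γ`,
and, for the modal rules, of expressions `bΓ` with a unary connective `b` and a context `Γ`. -/
structure MetaMultiset (L : Signature.{u}) (α : Type v) where
  formulas : Multiset (MetaFormula L α) := 0
  contexts : Multiset ℕ := 0
  boxed : Multiset ({c : L.Conn // L.arity c = 1} × ℕ) := 0

/-- The instance of a meta-multiset under a substitution `σ` of formulas for formula symbols and
a substitution `τ` of multisets of formulas for contexts. -/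
def MetaMultiset.inst {L : Signature.{u}} {α : Type v} (σ : ℕ → Formula L α)
    (τ : ℕ → Multiset (Formula L α)) (M : MetaMultiset L α) : Multiset (Formula L α) :=
  M.formulas.map (MetaFormula.inst σ) + M.contexts.bind τ +
    M.boxed.bind (fun b => (τ b.2).map (Formula.unary b.1))

structure MetaSequent (L : Signature.{u}) (α : Type v) where
  ant : MetaMultiset L α
  suc : MetaMultiset L α

def MetaSequent.inst {L : Signature.{u}} {α : Type v} (σ : ℕ → Formula L α)
    (τ : ℕ → Multiset (Formula L α)) (M : MetaSequent L α) : Sequent L α :=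
  ⟨M.ant.inst σ τ, M.suc.inst σ τ⟩

structure Rule (L : Signature.{u}) (α : Type v) where
  premises : Multiset (MetaSequent L α)
  conclusion : MetaSequent L α

/-- A sequent calculus is a set of rules. -/
abbrev Calculus (L : Signature.{u}) (α : Type v) := Set (Rule L α)

section Calculi

variable {L : Signature.{u}} {α : Type v}

/-- The substitutions `σ`, `τ` give an instance of the rule in the single-conclusion setting:
all sequents of the instance are single-conclusion. -/
def Rule.Admits (r : Rule L α) (σ : ℕ → Formula L α) (τ : ℕ → Multiset (Formula L α)) : Prop :=
  (r.conclusion.inst σ τ).Single ∧ ∀ M ∈ r.premises, (M.inst σ τ).Single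

/-- The rule is backward applicable to `S`: it has an instance with conclusion `S`. -/
def Rule.BackwardApplicable (r : Rule L α) (S : Sequent L α) : Prop :=
  ∃ σ τ, r.Admits σ τ ∧ r.conclusion.inst σ τ = S

/-- Derivability of a sequent by a proof tree whose nodes are instances of rules. -/
inductive Calculus.Derivable (G : Calculus L α) : Sequent L α → Prop
  | step (r : Rule L α) (hr : r ∈ G) (σ : ℕ → Formula L α) (τ : ℕ → Multiset (Formula L α))
      (h : r.Admits σ τ) (prem : ∀ M ∈ r.premises, Calculus.Derivable G (M.inst σ τ)) :
      Calculus.Derivable G (r.conclusion.inst σ τ)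

/-- `G` is a (single-conclusion) calculus for `Λ`: it derives `Γ ⇒ Δ` iff `Λ` proves the formula
`⊛Γ → Δ`, where an empty `Δ` is read as `0`. A multiset `Γ` is enumerated by a list. -/
def Calculus.IsCalculusFor (G : Calculus L α) {t : Translation L} (Λ : Logic t α) : Prop :=
  ∀ Γ : List (Formula L α),
    (∀ A, G.Derivable ⟨(Γ : Multiset (Formula L α)), {A}⟩ ↔ t.imp (t.fusion Γ) A ∈ Λ.thms) ∧
    (G.Derivable ⟨(Γ : Multiset (Formula L α)), 0⟩ ↔ t.imp (t.fusion Γ) t.zero ∈ Λ.thms)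

/-- Terminating (single-conclusion) calculi: only finitely many rules are backward applicable to
a given sequent, and there is a well-founded order on sequents in which the premises of every rule
instance with conclusion `S`, the proper subsequents of `S`, and every sequent that results from
`S` by removing the outermost box from at least one formula, lie below `S`. -/
def Calculus.Terminating (G : Calculus L α) : Prop :=
  (∀ S : Sequent L α, S.Single → {r | r ∈ G ∧ r.BackwardApplicable S}.Finite) ∧
  ∃ lt : Sequent L α → Sequent L α → Prop,
    WellFounded lt ∧
    (∀ R S T, lt R S → lt S T → lt R T) ∧
    (∀ r ∈ G, ∀ σ τ, r.Admits σ τ →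
      ∀ M ∈ r.premises, lt (M.inst σ τ) (r.conclusion.inst σ τ)) ∧
    (∀ S S' : Sequent L α, S.Single → S'.IsProperSub S → lt S' S) ∧
    (∀ b ∈ L.box, ∀ Γ Pi Δ Lam : Multiset (Formula L α), Pi + Lam ≠ 0 → (Δ + Lam).card ≤ 1 →
      lt ⟨Γ + Pi, Δ + Lam⟩ ⟨Γ + Pi.map (Formula.unary b), Δ + Lam.map (Formula.unary b)⟩)

/-! ### Semi-analytic rules -/

/-- A block `⟨Π, ψ̄ₛ ⇒ θ̄ₛ⟩ₛ` of premises that share the context `ctx = Π`;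
the rows are the pairs `(ψ̄ₛ, θ̄ₛ)`. -/
structure ClosedBlock (L : Signature.{u}) (α : Type v) where
  ctx : ℕ
  rows : List (Multiset (MetaFormula L α) × Multiset (MetaFormula L α))

def ClosedBlock.premises (B : ClosedBlock L α) : List (MetaSequent L α) :=
  B.rows.map fun x => ⟨{ formulas := x.1, contexts := {B.ctx} }, { formulas := x.2 }⟩

/-- All meta-formulas of the block have their variables in `V`. -/
def ClosedBlock.VarsIn (B : ClosedBlock L α) (V : Set (ℕ ⊕ α)) : Prop :=
  ∀ x ∈ B.rows, (∀ ψ ∈ x.1, ψ.vars ⊆ V) ∧ (∀ θ ∈ x.2, θ.vars ⊆ V)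

/-- A block `⟨Γ, φ̄ᵣ ⇒ Δ⟩ᵣ` of premises that share the contexts `ctx = Γ` and `sucCtx = Δ`;
the rows are the `φ̄ᵣ`. -/
structure OpenBlock (L : Signature.{u}) (α : Type v) where
  ctx : ℕ
  sucCtx : ℕ
  rows : List (Multiset (MetaFormula L α))

def OpenBlock.premises (B : OpenBlock L α) : List (MetaSequent L α) :=
  B.rows.map fun x => ⟨{ formulas := x, contexts := {B.ctx} }, { contexts := {B.sucCtx} }⟩

def OpenBlock.VarsIn (B : OpenBlock L α) (V : Set (ℕ ⊕ α)) : Prop :=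
  ∀ x ∈ B.rows, ∀ φ ∈ x, φ.vars ⊆ V

/-- A pair of blocks `⟨Γ, ψ̄ₛ ⇒ θ̄ₛ⟩ₛ` and `⟨Γ, φ̄ᵣ ⇒ Δ⟩ᵣ` with the same context `Γ`. -/
structure SharedBlock (L : Signature.{u}) (α : Type v) where
  ctx : ℕ
  sucCtx : ℕ
  closedRows : List (Multiset (MetaFormula L α) × Multiset (MetaFormula L α))
  openRows : List (Multiset (MetaFormula L α))

def SharedBlock.closedPart (B : SharedBlock L α) : ClosedBlock L α := ⟨B.ctx, B.closedRows⟩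

def SharedBlock.openPart (B : SharedBlock L α) : OpenBlock L α := ⟨B.ctx, B.sucCtx, B.openRows⟩

/-- Left semi-analytic rules: from `⟨⟨Πⱼ, ψ̄ⱼₛ ⇒ θ̄ⱼₛ⟩ₛ⟩ⱼ` and `⟨⟨Γᵢ, φ̄ᵢᵣ ⇒ Δᵢ⟩ᵣ⟩ᵢ` infer
`Π₁, …, Πₘ, Γ₁, …, Γₙ, φ ⇒ Δ₁, …, Δₙ`. The contexts are distinct variables, and `n ≥ 1`. -/
def Rule.IsLeftSemiAnalytic (r : Rule L α) : Prop :=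
  ∃ (P : List (ClosedBlock L α)) (B : List (OpenBlock L α)) (φ : MetaFormula L α),
    B ≠ [] ∧
    (P.map (·.ctx) ++ B.map (·.ctx) ++ B.map (·.sucCtx)).Nodup ∧
    (∀ b ∈ P, b.VarsIn φ.vars) ∧ (∀ b ∈ B, b.VarsIn φ.vars) ∧
    r.premises = ↑(P.flatMap ClosedBlock.premises ++ B.flatMap OpenBlock.premises) ∧
    r.conclusion =
      ⟨{ formulas := {φ}, contexts := ↑(P.map (·.ctx) ++ B.map (·.ctx)) },
        { contexts := ↑(B.map (·.sucCtx)) }⟩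

/-- Right semi-analytic rules: from `⟨⟨Γᵢ, φ̄ᵢᵣ ⇒ ψ̄ᵢᵣ⟩ᵣ⟩ᵢ` infer `Γ₁, …, Γₙ ⇒ φ`. -/
def Rule.IsRightSemiAnalytic (r : Rule L α) : Prop :=
  ∃ (P : List (ClosedBlock L α)) (φ : MetaFormula L α),
    (P.map (·.ctx)).Nodup ∧
    (∀ b ∈ P, b.VarsIn φ.vars) ∧
    r.premises = ↑(P.flatMap ClosedBlock.premises) ∧
    r.conclusion = ⟨{ contexts := ↑(P.map (·.ctx)) }, { formulas := {φ} }⟩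

/-- Context-sharing semi-analytic rules: from `⟨⟨Γᵢ, ψ̄ᵢₛ ⇒ θ̄ᵢₛ⟩ₛ⟩ᵢ` and
`⟨⟨Γᵢ, φ̄ᵢᵣ ⇒ Δᵢ⟩ᵣ⟩ᵢ` infer `Γ₁, …, Γₙ, φ ⇒ Δ₁, …, Δₙ`. -/
def Rule.IsContextSharingSemiAnalytic (r : Rule L α) : Prop :=
  ∃ (B : List (SharedBlock L α)) (φ : MetaFormula L α),
    B ≠ [] ∧
    (B.map (·.ctx) ++ B.map (·.sucCtx)).Nodup ∧
    (∀ b ∈ B, b.closedPart.VarsIn φ.vars ∧ b.openPart.VarsIn φ.vars) ∧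
    r.premises = ↑(B.flatMap (fun b => b.closedPart.premises) ++
      B.flatMap (fun b => b.openPart.premises)) ∧
    r.conclusion =
      ⟨{ formulas := {φ}, contexts := ↑(B.map (·.ctx)) },
        { contexts := ↑(B.map (·.sucCtx)) }⟩

/-- The modal rule `K`: from `Γ ⇒ φ` infer `□Γ ⇒ □φ`. -/
def Rule.IsModalK (r : Rule L α) : Prop :=
  ∃ b ∈ L.box, ∃ Γ x : ℕ,
    r.premises = {⟨{ contexts := {Γ} }, { formulas := {Formula.atom (Sum.inl x)} }⟩} ∧
    r.conclusion = ⟨{ boxed := {(b, Γ)} },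
      { formulas := {Formula.unary b (Formula.atom (Sum.inl x))} }⟩

/-- The modal rule `D`: from `Γ ⇒` infer `□Γ ⇒`. -/
def Rule.IsModalD (r : Rule L α) : Prop :=
  ∃ b ∈ L.box, ∃ Γ : ℕ,
    r.premises = {⟨{ contexts := {Γ} }, {}⟩} ∧
    r.conclusion = ⟨{ boxed := {(b, Γ)} }, {}⟩

def Rule.IsSemiAnalytic (r : Rule L α) : Prop :=
  r.IsLeftSemiAnalytic ∨ r.IsRightSemiAnalytic ∨ r.IsModalK ∨ r.IsModalD

/-- Any two elements of the multiset have the same variables. -/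
def SameVars (M : Multiset (MetaFormula L α)) : Prop :=
  ∀ φ ∈ M, ∀ ψ ∈ M, φ.vars = ψ.vars

/-- Focused axioms: rules without premises whose conclusion has one of the forms `φ ⇒ φ`,
`⇒ ᾱ`, `β̄ ⇒`, `Γ, φ̄ ⇒ Δ`, `Γ ⇒ φ̄, Δ`. -/
def Rule.IsFocusedAxiom (r : Rule L α) : Prop :=
  r.premises = 0 ∧
  ((∃ φ, r.conclusion = ⟨{ formulas := {φ} }, { formulas := {φ} }⟩) ∨
   (∃ A, SameVars A ∧ r.conclusion = ⟨{}, { formulas := A }⟩) ∨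
   (∃ B, SameVars B ∧ r.conclusion = ⟨{ formulas := B }, {}⟩) ∨
   (∃ F, ∃ Γ Δ : ℕ, SameVars F ∧ Γ ≠ Δ ∧
     r.conclusion = ⟨{ formulas := F, contexts := {Γ} }, { contexts := {Δ} }⟩) ∨
   (∃ F, ∃ Γ Δ : ℕ, SameVars F ∧ Γ ≠ Δ ∧
     r.conclusion = ⟨{ contexts := {Γ} }, { formulas := F, contexts := {Δ} }⟩))

/-- The calculus consists of focused axioms, semi-analytic rules and context-sharing semi-analytic
rules, where, as always, the rule `D` may be present only together with the rule `K`. -/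
def Calculus.IsContextSharingSemiAnalytic (G : Calculus L α) : Prop :=
  (∀ r ∈ G, r.IsFocusedAxiom ∨ r.IsSemiAnalytic ∨ r.IsContextSharingSemiAnalytic) ∧
  ((∃ r ∈ G, r.IsModalD) → ∃ r ∈ G, r.IsModalK)

/-- `G` has weak `H`-uniform interpolation (single-conclusion setting). The weak left interpolant
of a sequent `S` is `I S`, the weak right interpolant of a sequent `Γ ⇒` is `J Γ`. -/
def Calculus.HasWeakUniformInterpolation (G H : Calculus L α) : Prop :=
  ∀ p : α, ∃ (I : Sequent L α → Formula L α) (J : Multiset (Formula L α) → Formula L α),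
    (∀ S : Sequent L α, S.Single →
      (I S).Free p ∧
      H.Derivable (S.mul ⟨{I S}, 0⟩) ∧
      ∀ Γ : Multiset (Formula L α), (∀ A ∈ Γ, A.Free p) →
        G.Derivable (S.mul ⟨Γ, 0⟩) → H.Derivable ⟨J S.ant ::ₘ Γ, {I S}⟩) ∧
    (∀ T : Multiset (Formula L α),
      (J T).Free p ∧
      H.Derivable ⟨T, {J T}⟩ ∧
      ∀ Γ Δ : Multiset (Formula L α), (∀ A ∈ Γ, A.Free p) → (∀ A ∈ Δ, A.Free p) →
        G.Derivable ⟨T + Γ, Δ⟩ → H.Derivable ⟨J T ::ₘ Γ, Δ⟩)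

end Calculi

end SemiAnalytic

/-! Since the logic contains intuitionistic logic, its Lindenbaum algebra is a Heyting algebra in
which fusion is meet, and `H` derives a sequent iff the meet of the antecedent lies below the join
of the succedent. Weakening, contraction and cut thus come for free at the level of values. The
values of `p`-free formulas form a Heyting subalgebra `F`. What must be found is, for each
antecedent `X`, the least element of `F` above `X` (`IsPost`), and for each sequent `X ⇒ Y`, the
greatest `f` in `F` with `f ⊓ X ≤ Y` (`IsPre`).

Both are built by well-founded induction along the termination order (`exists_interpolants`). A
sequent depends on finitely many smaller ones (`lower`), so their interpolants, the boxes of these,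
and the `p`-free members of the antecedent generate a finite sublattice `M` of `F`. For `X` take
`E`, the meet of all `m ⇨ m'` with `m, m'` in `M` and `X ⊓ m ≤ m'`. For `X ⇒ B` with `B` not
`p`-free take `E ⇨ a`, where `a` is the greatest element of `M` with `a ⊓ X ≤ B`.

That these finitely many tests suffice is proved by an inner induction on derivations of `X, Γ ⇒ Δ`
with `Γ` `p`-free (`exists_isPost`, `exists_isPre`). If the main formula belongs to the sequent
being interpolated, deleting the `Γ`-parts turns the premises into smaller sequents; their
interpolants lie in `M`, so `Γ` can be replaced by one element of `M`, and the rule is applied again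
with it in every context. If the main formula is `p`-free, so are all side formulas, and the rule is
applied again with `E` in place of `X`: premises that receive all of `X` are covered by the inner
induction, the others by the outer one. -/

namespace SemiAnalytic

universe u v w

/-! ### Intuitionistic rules with a fixed, shared antecedent -/

namespace IPCDerivable

variable {L : Signature.{u}} {α : Type v} {t : Translation L}
  {Γ Γ' Δ : Multiset (Formula L α)} {φ ψ : Formula L α}

theorem weaken (h : IPCDerivable t Γ Δ) (Γ' : Multiset (Formula L α)) :
    IPCDerivable t (Γ' + Γ) Δ := by
  induction Γ' using Multiset.induction_on with
  | empty => simpa using h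
  | cons a s ih => rw [Multiset.cons_add]; exact weakL _ _ _ ih

theorem contr_of_mem (hφ : φ ∈ Γ) (h : IPCDerivable t (φ ::ₘ Γ) Δ) : IPCDerivable t Γ Δ := by
  obtain ⟨Γ₀, rfl⟩ := Multiset.exists_cons_of_mem hφ
  exact contrL _ _ _ h

theorem contr_le (hle : Γ' ≤ Γ) (h : IPCDerivable t (Γ' + Γ) Δ) : IPCDerivable t Γ Δ := by
  induction Γ' using Multiset.induction_on with
  | empty => simpa using h
  | cons a s ih =>
    refine ih ((Multiset.le_cons_self s a).trans hle) (contr_of_mem (φ := a) ?_ ?_)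
    · exact Multiset.mem_add.2 (Or.inr (Multiset.mem_of_le hle (Multiset.mem_cons_self a s)))
    · rwa [Multiset.cons_add] at h

theorem of_mem (hφ : φ ∈ Γ) : IPCDerivable t Γ {φ} := by
  obtain ⟨Γ₀, rfl⟩ := Multiset.exists_cons_of_mem hφ
  rw [← Multiset.singleton_add, add_comm]; exact (id (t := t) φ).weaken Γ₀

theorem impL_mem (hm : t.imp φ ψ ∈ Γ) (h₁ : IPCDerivable t Γ {φ})
    (h₂ : IPCDerivable t (ψ ::ₘ Γ) Δ) : IPCDerivable t Γ Δ :=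
  contr_of_mem hm <| by
    have h := impL _ _ _ _ _ h₁ h₂
    rw [← Multiset.add_cons] at h
    exact contr_le (Multiset.le_cons_self _ _) h

theorem andL₁_mem (hm : t.and φ ψ ∈ Γ) (h : IPCDerivable t (φ ::ₘ Γ) Δ) : IPCDerivable t Γ Δ :=
  contr_of_mem hm (andL₁ _ _ _ _ h)

theorem andL₂_mem (hm : t.and φ ψ ∈ Γ) (h : IPCDerivable t (ψ ::ₘ Γ) Δ) : IPCDerivable t Γ Δ :=
  contr_of_mem hm (andL₂ _ _ _ _ h)

theorem orL_mem (hm : t.or φ ψ ∈ Γ) (h₁ : IPCDerivable t (φ ::ₘ Γ) Δ)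
    (h₂ : IPCDerivable t (ψ ::ₘ Γ) Δ) : IPCDerivable t Γ Δ :=
  contr_of_mem hm (orL _ _ _ _ h₁ h₂)

theorem fusL_mem (hm : t.fus φ ψ ∈ Γ) (h : IPCDerivable t (φ ::ₘ ψ ::ₘ Γ) Δ) :
    IPCDerivable t Γ Δ :=
  contr_of_mem hm (fusL _ _ _ _ h)

theorem fusR_shared (h₁ : IPCDerivable t Γ {φ}) (h₂ : IPCDerivable t Γ {ψ}) :
    IPCDerivable t Γ {t.fus φ ψ} :=
  contr_le le_rfl (fusR _ _ _ _ h₁ h₂)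

end IPCDerivable

/-! ### The Lindenbaum algebra -/

section Lindenbaum

variable {L : Signature.{u}} {α : Type v} {t : Translation L}

/-- A logic that contains intuitionistic logic. -/
structure SuperIntLogic (t : Translation L) (α : Type v) where
  logic : Logic t α
  ipc : IPC t α ⊆ logic.thms

namespace SuperIntLogic

variable (Λ : SuperIntLogic t α)

/-- Provable implication. -/
def Le (φ ψ : Formula L α) : Prop := t.imp φ ψ ∈ Λ.logic.thms

variable {Λ} {φ ψ χ θ : Formula L α}

theorem le_of_ipc (h : IPCDerivable t {φ} {ψ}) : Λ.Le φ ψ :=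
  Λ.ipc (IPCDerivable.impR _ _ _ (by simpa using h))

theorem le_of_ipc₁ (h : IPCDerivable t {t.imp φ ψ} {t.imp χ θ}) (h₁ : Λ.Le φ ψ) : Λ.Le χ θ :=
  Λ.logic.mp _ _ (le_of_ipc h) h₁

/-- The intuitionistic calculus has no cut rule, so hypotheses about the logic are combined by modus
ponens with a single intuitionistic theorem that has them as antecedents. -/
theorem le_of_ipc₂ {a b c d e f : Formula L α}
    (h : IPCDerivable t (t.imp a b ::ₘ t.imp c d ::ₘ 0) {t.imp e f})
    (h₁ : Λ.Le a b) (h₂ : Λ.Le c d) : Λ.Le e f := by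
  refine Λ.logic.mp _ _ (Λ.logic.mp _ _ (Λ.ipc (IPCDerivable.impR _ _ _
    (IPCDerivable.impR _ _ _ h))) h₂) h₁

open IPCDerivable

theorem Le.refl (φ) : Λ.Le φ φ := le_of_ipc (IPCDerivable.id _)

theorem Le.trans (h₁ : Λ.Le φ ψ) (h₂ : Λ.Le ψ χ) : Λ.Le φ χ := by
  refine le_of_ipc₂ (impR _ _ _ ?_) h₁ h₂
  refine impL_mem (φ := φ) (ψ := ψ) (by simp) (of_mem (by simp)) ?_
  exact impL_mem (φ := ψ) (ψ := χ) (by simp) (of_mem (by simp)) (of_mem (by simp))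

theorem and_le_left : Λ.Le (t.and φ ψ) φ :=
  le_of_ipc (andL₁_mem (φ := φ) (ψ := ψ) (by simp) (of_mem (by simp)))

theorem and_le_right : Λ.Le (t.and φ ψ) ψ :=
  le_of_ipc (andL₂_mem (φ := φ) (ψ := ψ) (by simp) (of_mem (by simp)))

theorem le_and (h₁ : Λ.Le φ ψ) (h₂ : Λ.Le φ χ) : Λ.Le φ (t.and ψ χ) := by
  refine le_of_ipc₂ (impR _ _ _ (andR _ _ _ ?_ ?_)) h₁ h₂
  · exact impL_mem (φ := φ) (ψ := ψ) (by simp) (of_mem (by simp)) (of_mem (by simp))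
  · exact impL_mem (φ := φ) (ψ := χ) (by simp) (of_mem (by simp)) (of_mem (by simp))

theorem le_or_left : Λ.Le φ (t.or φ ψ) := le_of_ipc (orR₁ _ _ _ (IPCDerivable.id _))

theorem le_or_right : Λ.Le ψ (t.or φ ψ) := le_of_ipc (orR₂ _ _ _ (IPCDerivable.id _))

theorem or_le (h₁ : Λ.Le φ χ) (h₂ : Λ.Le ψ χ) : Λ.Le (t.or φ ψ) χ := by
  refine le_of_ipc₂ (impR _ _ _ (orL_mem (φ := φ) (ψ := ψ) (by simp) ?_ ?_)) h₁ h₂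
  · exact impL_mem (φ := φ) (ψ := χ) (by simp) (of_mem (by simp)) (of_mem (by simp))
  · exact impL_mem (φ := ψ) (ψ := χ) (by simp) (of_mem (by simp)) (of_mem (by simp))

theorem le_top : Λ.Le φ t.top := le_of_ipc (IPCDerivable.top _)

theorem bot_le : Λ.Le t.bot φ := le_of_ipc (IPCDerivable.bot 0 _ (by simp))

theorem le_imp_iff : Λ.Le φ (t.imp ψ χ) ↔ Λ.Le (t.and φ ψ) χ := by
  constructor
  · refine le_of_ipc₁ (impR _ _ _ ?_)
    refine andL₁_mem (φ := φ) (ψ := ψ) (by simp) (andL₂_mem (φ := φ) (ψ := ψ) (by simp) ?_)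
    refine impL_mem (φ := φ) (ψ := t.imp ψ χ) (by simp) (of_mem (by simp)) ?_
    exact impL_mem (φ := ψ) (ψ := χ) (by simp) (of_mem (by simp)) (of_mem (by simp))
  · refine le_of_ipc₁ (impR _ _ _ (impR _ _ _ ?_))
    exact impL_mem (φ := t.and φ ψ) (ψ := χ) (by simp)
      (andR _ _ _ (of_mem (by simp)) (of_mem (by simp))) (of_mem (by simp))

theorem fus_le_and : Λ.Le (t.fus φ ψ) (t.and φ ψ) :=
  le_of_ipc (fusL_mem (φ := φ) (ψ := ψ) (by simp)
    (andR _ _ _ (of_mem (by simp)) (of_mem (by simp))))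

theorem and_le_fus : Λ.Le (t.and φ ψ) (t.fus φ ψ) :=
  le_of_ipc (andL₁_mem (φ := φ) (ψ := ψ) (by simp) (andL₂_mem (φ := φ) (ψ := ψ) (by simp)
    (fusR_shared (of_mem (by simp)) (of_mem (by simp)))))

theorem top_le_one : Λ.Le t.top (t.one : Formula L α) :=
  le_of_ipc (by simpa using (one (t := t) (α := α)).weaken {t.top})

theorem zero_le_bot : Λ.Le t.zero (t.bot : Formula L α) := le_of_ipc (weakR _ _ zero)

variable (Λ)

abbrev setoid : Setoid (Formula L α) where
  r φ ψ := Λ.Le φ ψ ∧ Λ.Le ψ φ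
  iseqv :=
    ⟨fun _ => ⟨Le.refl _, Le.refl _⟩, fun h => ⟨h.2, h.1⟩,
      fun h k => ⟨h.1.trans k.1, k.2.trans h.2⟩⟩

/-- Formulas up to provable equivalence. -/
def Lindenbaum : Type (max u v) := Quotient Λ.setoid

/-- The class of a formula. -/
def cls (φ : Formula L α) : Λ.Lindenbaum := Quotient.mk Λ.setoid φ

variable {Λ}

theorem and_mono {φ' ψ' : Formula L α} (h : Λ.Le φ φ') (k : Λ.Le ψ ψ') :
    Λ.Le (t.and φ ψ) (t.and φ' ψ') :=
  le_and (and_le_left.trans h) (and_le_right.trans k)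

theorem or_mono {φ' ψ' : Formula L α} (h : Λ.Le φ φ') (k : Λ.Le ψ ψ') :
    Λ.Le (t.or φ ψ) (t.or φ' ψ') :=
  or_le (h.trans le_or_left) (k.trans le_or_right)

theorem imp_mono {φ' ψ' : Formula L α} (h : Λ.Le φ' φ) (k : Λ.Le ψ ψ') :
    Λ.Le (t.imp φ ψ) (t.imp φ' ψ') :=
  le_imp_iff.2 (((and_mono (Le.refl _) h).trans (le_imp_iff.1 (Le.refl _))).trans k)

instance : LE Λ.Lindenbaum where
  le := Quotient.lift₂ Λ.Le fun _ _ _ _ h k =>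
    propext ⟨fun l => (h.2.trans l).trans k.1, fun l => (h.1.trans l).trans k.2⟩

instance : HeytingAlgebra Λ.Lindenbaum where
  le_refl a := Quotient.inductionOn a Le.refl
  le_trans a b c := Quotient.inductionOn₃ a b c fun _ _ _ h k => Le.trans h k
  le_antisymm a b := Quotient.inductionOn₂ a b fun _ _ h k => Quotient.sound ⟨h, k⟩
  inf := Quotient.map₂ t.and fun _ _ h _ _ k => ⟨and_mono h.1 k.1, and_mono h.2 k.2⟩
  inf_le_left a b := Quotient.inductionOn₂ a b fun _ _ => and_le_left
  inf_le_right a b := Quotient.inductionOn₂ a b fun _ _ => and_le_right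
  le_inf a b c := Quotient.inductionOn₃ a b c fun _ _ _ h k => le_and h k
  sup := Quotient.map₂ t.or fun _ _ h _ _ k => ⟨or_mono h.1 k.1, or_mono h.2 k.2⟩
  le_sup_left a b := Quotient.inductionOn₂ a b fun _ _ => le_or_left
  le_sup_right a b := Quotient.inductionOn₂ a b fun _ _ => le_or_right
  sup_le a b c := Quotient.inductionOn₃ a b c fun _ _ _ h k => or_le h k
  top := Λ.cls t.top
  le_top a := Quotient.inductionOn a fun _ => le_top
  bot := Λ.cls t.bot
  bot_le a := Quotient.inductionOn a fun _ => bot_le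
  himp := Quotient.map₂ t.imp fun _ _ h _ _ k => ⟨imp_mono h.2 k.1, imp_mono h.1 k.2⟩
  le_himp_iff a b c := Quotient.inductionOn₃ a b c fun _ _ _ => le_imp_iff
  compl := Quotient.map (fun φ => t.imp φ t.bot)
    fun _ _ h => ⟨imp_mono h.2 (Le.refl _), imp_mono h.1 (Le.refl _)⟩
  himp_bot a := Quotient.inductionOn a fun _ => rfl

/-- One inequality uses weakening, the other contraction. -/
theorem cls_fus : Λ.cls (t.fus φ ψ) = Λ.cls φ ⊓ Λ.cls ψ :=
  Quotient.sound ⟨fus_le_and, and_le_fus⟩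

theorem cls_one : Λ.cls t.one = ⊤ := Quotient.sound ⟨le_top, top_le_one⟩

theorem cls_zero : Λ.cls t.zero = ⊥ := Quotient.sound ⟨zero_le_bot, bot_le⟩

theorem cls_fusion (l : List (Formula L α)) :
    Λ.cls (t.fusion l) = ((l : Multiset (Formula L α)).map Λ.cls).inf := by
  induction l with
  | nil => simp [Translation.fusion, cls_one]
  | cons A l ih =>
    cases l with
    | nil => simp [Translation.fusion]
    | cons B l => rw [Translation.fusion, cls_fus, ih, ← Multiset.cons_coe]; simp

end SuperIntLogic

/-- An interpretation of the formulas in a Heyting algebra for which a calculus is complete. -/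
structure HeytingModel (t : Translation L) (H : Calculus L α) (Q : Type w) [HeytingAlgebra Q] where
  val : Formula L α → Q
  val_and : ∀ φ ψ, val (t.and φ ψ) = val φ ⊓ val ψ
  val_or : ∀ φ ψ, val (t.or φ ψ) = val φ ⊔ val ψ
  val_imp : ∀ φ ψ, val (t.imp φ ψ) = val φ ⇨ val ψ
  val_top : val t.top = ⊤
  val_bot : val t.bot = ⊥
  derivable_iff : ∀ S : Sequent L α, S.Single →
    (H.Derivable S ↔ (S.ant.map val).inf ≤ (S.suc.map val).sup)

/-- The Lindenbaum algebra of a logic as a model of a calculus for the logic. -/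
def SuperIntLogic.model (Λ : SuperIntLogic t α) {H : Calculus L α}
    (hH : H.IsCalculusFor Λ.logic) : HeytingModel t H Λ.Lindenbaum where
  val := Λ.cls
  val_and _ _ := rfl
  val_or _ _ := rfl
  val_imp _ _ := rfl
  val_top := rfl
  val_bot := rfl
  derivable_iff := by
    rintro ⟨Γ, Δ⟩ hS
    induction Γ using Quotient.inductionOn with | _ l =>
    rcases Nat.le_one_iff_eq_zero_or_eq_one.1 hS with h | h
    · obtain rfl := Multiset.card_eq_zero.1 h
      refine (hH l).2.trans ?_
      change Λ.cls _ ≤ Λ.cls _ ↔ _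
      rw [SuperIntLogic.cls_fusion, SuperIntLogic.cls_zero]
      simp
    · obtain ⟨A, rfl⟩ := Multiset.card_eq_one.1 h
      refine ((hH l).1 A).trans ?_
      change Λ.cls _ ≤ Λ.cls _ ↔ _
      rw [SuperIntLogic.cls_fusion]
      simp

end Lindenbaum

/-! ### Finite approximations in Heyting algebras -/

section Heyting

variable {Q : Type w} [HeytingAlgebra Q]

/-- The underlying sets of Heyting subalgebras. -/
structure IsHeytingSubalgebra (F : Set Q) : Prop where
  top_mem : ⊤ ∈ F
  bot_mem : ⊥ ∈ F
  isSublattice : IsSublattice F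
  himp_mem : ∀ a ∈ F, ∀ b ∈ F, a ⇨ b ∈ F

theorem exists_isGLB_mem {F T : Set Q} (top_mem : ⊤ ∈ F) (hF : InfClosed F) (hT : T.Finite)
    (hTF : T ⊆ F) : ∃ e ∈ F, IsGLB T e := by
  refine ⟨hT.toFinset.inf id, ?_, ?_⟩
  · exact Finset.inf_induction top_mem (fun a ha b hb => hF ha hb) fun a ha => hTF (by simpa using ha)
  · simpa using Finset.isGLB_inf_id (s := hT.toFinset)

theorem exists_isLUB_mem {F T : Set Q} (bot_mem : ⊥ ∈ F) (hF : SupClosed F) (hT : T.Finite)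
    (hTF : T ⊆ F) : ∃ e ∈ F, IsLUB T e := by
  refine ⟨hT.toFinset.sup id, ?_, ?_⟩
  · exact Finset.sup_induction bot_mem (fun a ha b hb => hF ha hb) fun a ha => hTF (by simpa using ha)
  · simpa using Finset.isLUB_sup_id (s := hT.toFinset)

/-- Finite bounded sublattices. -/
structure IsFiniteBoundedSublattice (M : Set Q) : Prop where
  finite : M.Finite
  top_mem : ⊤ ∈ M
  bot_mem : ⊥ ∈ M
  isSublattice : IsSublattice M

/-- A finitely generated distributive lattice is finite. Closing under `⇨` as well would lose this:
Heyting algebras on finitely many generators can be infinite. -/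
theorem IsHeytingSubalgebra.exists_finite_sublattice {F U : Set Q} (hF : IsHeytingSubalgebra F)
    (hU : U.Finite) (hUF : U ⊆ F) : ∃ M, IsFiniteBoundedSublattice M ∧ U ⊆ M ∧ M ⊆ F := by
  refine ⟨latticeClosure (insert ⊤ (insert ⊥ U)),
    ⟨((hU.insert _).insert _).latticeClosure, subset_latticeClosure (by simp),
      subset_latticeClosure (by simp), isSublattice_latticeClosure⟩,
    fun a ha => subset_latticeClosure (by simp [ha]), latticeClosure_min ?_ hF.isSublattice⟩
  rintro a (rfl | rfl | ha)
  exacts [hF.top_mem, hF.bot_mem, hUF ha]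

namespace IsFiniteBoundedSublattice

variable {M : Set Q} (hM : IsFiniteBoundedSublattice M)
include hM

theorem exists_isLeast (x : Q) : ∃ m, IsLeast {m | m ∈ M ∧ x ≤ m} m := by
  obtain ⟨e, he, hG⟩ := exists_isGLB_mem hM.top_mem hM.isSublattice.infClosed
    (hM.finite.subset (Set.sep_subset M (x ≤ ·))) (Set.sep_subset _ _)
  exact ⟨e, ⟨he, hG.2 fun a ha => ha.2⟩, hG.1⟩

theorem exists_isGreatest (x : Q) : ∃ m, IsGreatest {m | m ∈ M ∧ m ≤ x} m := by
  obtain ⟨e, he, hG⟩ := exists_isLUB_mem hM.bot_mem hM.isSublattice.supClosed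
    (hM.finite.subset (Set.sep_subset M (· ≤ x))) (Set.sep_subset _ _)
  exact ⟨e, ⟨he, hG.2 fun a ha => ha.2⟩, hG.1⟩

/-- The witness is the meet of all `m ⇨ m'` that lie above `x`. It may leave `M`, but not `F`, and
it inherits from `x` every inequality with parameters in `M`. -/
theorem exists_upper_approx {F : Set Q} (hF : IsHeytingSubalgebra F) (hMF : M ⊆ F) (x : Q) :
    ∃ e ∈ F, x ≤ e ∧ ∀ m ∈ M, ∀ m' ∈ M, x ⊓ m ≤ m' → e ⊓ m ≤ m' := by
  obtain ⟨e, he, hG⟩ := exists_isGLB_mem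
    (T := (fun q : Q × Q => q.1 ⇨ q.2) '' {q | q ∈ M ×ˢ M ∧ x ⊓ q.1 ≤ q.2}) hF.top_mem
    hF.isSublattice.infClosed
    (((hM.finite.prod hM.finite).subset (Set.sep_subset _ _)).image _) (by
      rintro _ ⟨q, ⟨hq, -⟩, rfl⟩
      exact hF.himp_mem _ (hMF hq.1) _ (hMF hq.2))
  refine ⟨e, he, hG.2 ?_, fun m hm m' hm' h => ?_⟩
  · rintro _ ⟨q, ⟨-, hq⟩, rfl⟩
    exact le_himp_iff.2 hq
  · exact le_himp_iff.1 (hG.1 ⟨(m, m'), ⟨⟨hm, hm'⟩, h⟩, rfl⟩)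

end IsFiniteBoundedSublattice

end Heyting

/-! ### Splitting of multisets -/

section Multisets

variable {β : Type*}

theorem exists_refinement {A B C D : Multiset β} (h : A + B = C + D) :
    ∃ s g s' g', C = s + g ∧ D = s' + g' ∧ s + s' = A ∧ g + g' = B := by
  classical
  have hc : ∀ a, A.count a + B.count a = C.count a + D.count a := fun a => by
    simpa using congrArg (Multiset.count a) h
  -- The overlap of `A` and `C` is chosen as large as possible; the other three parts are then
  -- forced.
  refine ⟨A ∩ C, C - A, A - C, B - (C - A), ?_, ?_, ?_, ?_⟩ <;> ext a <;> have := hc a <;>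
    simp only [Multiset.count_add, Multiset.count_inter, Multiset.count_sub] <;> omega

theorem exists_split_sum {l : List ℕ} (hl : l.Nodup) {τ : ℕ → Multiset β} {A B : Multiset β}
    (h : A + B = (l.map τ).sum) :
    ∃ s g : ℕ → Multiset β, (∀ c ∈ l, τ c = s c + g c) ∧ (l.map s).sum = A ∧
      (l.map g).sum = B := by
  induction l generalizing A B with
  | nil => exact ⟨0, 0, by simp, by simp_all⟩
  | cons c l ih =>
    rw [List.map_cons, List.sum_cons] at h
    obtain ⟨s₁, g₁, s₂, g₂, h₁, h₂, rfl, rfl⟩ := exists_refinement h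
    obtain ⟨hc, hl⟩ := List.nodup_cons.1 hl
    obtain ⟨s, g, hsg, hs, hg⟩ := ih hl h₂.symm
    -- Since the contexts are distinct, prescribing a value at `c` does not disturb the splitting of
    -- the tail.
    have key : ∀ (f : ℕ → Multiset β) (a : Multiset β),
        l.map (Function.update f c a) = l.map f := fun f a =>
      List.map_congr_left fun d hd => Function.update_of_ne (ne_of_mem_of_not_mem hd hc) _ _
    refine ⟨Function.update s c s₁, Function.update g c g₁, ?_, ?_, ?_⟩
    · intro d hd
      rcases eq_or_ne d c with rfl | hdc
      · simpa using h₁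
      · simpa [hdc] using hsg d ((List.mem_cons.1 hd).resolve_left hdc)
    · simp [key, hs]
    · simp [key, hg]

theorem coe_bind_eq_sum {γ : Type*} (l : List ℕ) (τ : ℕ → Multiset γ) :
    (l : Multiset ℕ).bind τ = (l.map τ).sum := by
  simp [Multiset.bind, Multiset.join]

theorem mem_sum_map {γ : Type*} {l : List ℕ} {τ : ℕ → Multiset γ} {c : ℕ} (hc : c ∈ l) :
    τ c ≤ (l.map τ).sum := by
  obtain ⟨l₁, l₂, rfl⟩ := List.append_of_mem hc
  simp only [List.map_append, List.map_cons, List.sum_append, List.sum_cons]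
  exact (Multiset.le_add_right _ _).trans (Multiset.le_add_left _ _)

/-- Applied with a box as `f`, this divides the premise of a modal rule according to a division of
its boxed antecedent. -/
theorem exists_of_map_eq_add {γ : Type*} {f : β → γ} {m : Multiset β} {A B : Multiset γ}
    (h : m.map f = A + B) : ∃ m₁ m₂, m = m₁ + m₂ ∧ m₁.map f = A ∧ m₂.map f = B := by
  induction m using Multiset.induction_on generalizing A B with
  | empty =>
    obtain ⟨rfl, rfl⟩ := add_eq_zero.1 (h.symm.trans (Multiset.map_zero f))
    exact ⟨0, 0, rfl, rfl, rfl⟩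
  | cons b m ih =>
    rw [Multiset.map_cons] at h
    rcases Multiset.mem_add.1 (h ▸ Multiset.mem_cons_self (f b) _) with hb | hb
    · obtain ⟨A, rfl⟩ := Multiset.exists_cons_of_mem hb
      rw [Multiset.cons_add, Multiset.cons_inj_right] at h
      obtain ⟨m₁, m₂, rfl, rfl, rfl⟩ := ih h
      exact ⟨b ::ₘ m₁, m₂, by simp, by simp, rfl⟩
    · obtain ⟨B, rfl⟩ := Multiset.exists_cons_of_mem hb
      rw [Multiset.add_cons, Multiset.cons_inj_right] at h
      obtain ⟨m₁, m₂, rfl, rfl, rfl⟩ := ih h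
      exact ⟨m₁, b ::ₘ m₂, by simp, rfl, by simp⟩

/-- All these multisets lie below the sum of `n` copies of `T`, which has finitely many
submultisets. -/
theorem finite_multisets {T : Set β} (hT : T.Finite) (n : ℕ) :
    {m : Multiset β | (∀ a ∈ m, a ∈ T) ∧ m.card ≤ n}.Finite := by
  classical
  refine ((n • hT.toFinset.val).powerset.toFinset.finite_toSet).subset ?_
  rintro m ⟨hm, hc⟩
  simp only [Finset.mem_coe, Multiset.mem_toFinset, Multiset.mem_powerset]
  refine Multiset.le_iff_count.2 fun a => ?_
  rw [Multiset.count_nsmul]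
  by_cases ha : a ∈ m
  · rw [Multiset.count_eq_one_of_mem hT.toFinset.nodup (by simpa using hm a ha), mul_one]
    exact (Multiset.count_le_card a m).trans hc
  · simp [Multiset.count_eq_zero_of_notMem ha]

end Multisets

/-! ### Variables and subformulas -/

namespace Formula

variable {L : Signature.{u}} {α : Type v} {β : Type w}

theorem vars_subst (f : α → Formula L β) (φ : Formula L α) :
    (φ.subst f).vars = ⋃ a ∈ φ.vars, (f a).vars := by
  induction φ with
  | atom a => simp [subst, vars]
  | conn c args ih =>
    ext x
    simp only [subst, vars, ih, Set.mem_iUnion]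
    tauto

theorem free_subst {f : α → Formula L β} {φ : Formula L α} {p : β} :
    (φ.subst f).Free p ↔ ∀ a ∈ φ.vars, (f a).Free p := by
  simp [Free, vars_subst]

theorem free_unary {b : {c : L.Conn // L.arity c = 1}} {φ : Formula L α} {p : α}
    (h : φ.Free p) : (unary b φ).Free p := by
  simp only [Free, unary, vars, Set.mem_iUnion, not_exists]
  exact fun _ => h

theorem free_of_unary {b : {c : L.Conn // L.arity c = 1}} {φ : Formula L α} {p : α}
    (h : (unary b φ).Free p) : φ.Free p := by
  simp only [Free, unary, vars, Set.mem_iUnion, not_exists] at h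
  exact h ⟨0, by simp [b.2]⟩

theorem unary_injective (b : {c : L.Conn // L.arity c = 1}) :
    Function.Injective (unary b : Formula L α → Formula L α) := by
  intro φ ψ h
  simp only [unary, conn.injEq, heq_eq_eq, true_and] at h
  exact congrFun h ⟨0, by simp [b.2]⟩

/-- The set of subformulas. -/
def subs : Formula L α → Set (Formula L α)
  | atom a => {atom a}
  | conn c args => insert (conn c args) (⋃ i, (args i).subs)

theorem mem_subs_self (φ : Formula L α) : φ ∈ φ.subs := by
  cases φ <;> simp [subs]

theorem finite_subs (φ : Formula L α) : φ.subs.Finite := by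
  induction φ with
  | atom a => exact Set.finite_singleton _
  | conn c args ih => exact (Set.finite_iUnion ih).insert _

theorem mem_subs_unary (b : {c : L.Conn // L.arity c = 1}) (φ : Formula L α) :
    φ ∈ (unary b φ).subs :=
  Or.inr (Set.mem_iUnion.2 ⟨⟨0, by simp [b.2]⟩, mem_subs_self φ⟩)

theorem mem_subs_subst (f : α → Formula L β) {φ : Formula L α} {a : α} (ha : a ∈ φ.vars) :
    f a ∈ (φ.subst f).subs := by
  induction φ with
  | atom b =>
    obtain rfl := ha
    exact mem_subs_self _
  | conn c args ih =>
    obtain ⟨i, hi⟩ := Set.mem_iUnion.1 ha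
    exact Or.inr (Set.mem_iUnion.2 ⟨i, ih i hi⟩)

end Formula

/-! ### Finiteness of the set of premises -/

section Premises

variable {L : Signature.{u}} {α : Type v}

theorem MetaFormula.free_of_vars_subset {σ : ℕ → Formula L α} {p : α} {φ ψ : MetaFormula L α}
    (h : ψ.vars ⊆ φ.vars) (hφ : (φ.inst σ).Free p) : (ψ.inst σ).Free p :=
  Formula.free_subst.2 fun a ha => Formula.free_subst.1 hφ a (h ha)

theorem MetaFormula.finite_inst {T : Set (Formula L α)} (hT : T.Finite) (φ : MetaFormula L α) :
    {χ | ∃ σ : ℕ → Formula L α, (∀ x, Sum.inl x ∈ φ.vars → σ x ∈ T) ∧ φ.inst σ = χ}.Finite := by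
  induction φ with
  | atom a =>
    cases a with
    | inl x =>
      refine hT.subset ?_
      rintro _ ⟨σ, h, rfl⟩
      exact h x rfl
    | inr a =>
      refine (Set.finite_singleton (Formula.atom a)).subset ?_
      rintro _ ⟨σ, -, rfl⟩
      rfl
  | conn c args ih =>
    refine ((Set.Finite.pi' ih).image (Formula.conn c)).subset ?_
    rintro _ ⟨σ, h, rfl⟩
    exact ⟨fun i => MetaFormula.inst σ (args i),
      fun i => ⟨σ, fun x hx => h x (Set.mem_iUnion.2 ⟨i, hx⟩), rfl⟩, rfl⟩

theorem MetaFormula.finite_map_inst {T : Set (Formula L α)} (hT : T.Finite)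
    (fs : Multiset (MetaFormula L α)) :
    {m | ∃ σ : ℕ → Formula L α, (∀ φ ∈ fs, ∀ x, Sum.inl x ∈ φ.vars → σ x ∈ T) ∧
      fs.map (MetaFormula.inst σ) = m}.Finite := by
  induction fs using Multiset.induction_on with
  | empty => exact (Set.finite_singleton 0).subset (by rintro _ ⟨σ, -, rfl⟩; rfl)
  | cons φ fs ih =>
    refine (Set.Finite.image2 Multiset.cons (MetaFormula.finite_inst hT φ) ih).subset ?_
    rintro _ ⟨σ, h, rfl⟩
    refine ⟨_, ⟨σ, h φ (by simp), rfl⟩, _, ⟨σ, fun ψ hψ => h ψ (by simp [hψ]), rfl⟩, by simp⟩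

theorem finite_bind {T : Set (Multiset (Formula L α))} (hT : T.Finite) (cs : Multiset ℕ) :
    {m | ∃ τ : ℕ → Multiset (Formula L α), (∀ c ∈ cs, τ c ∈ T) ∧ cs.bind τ = m}.Finite := by
  induction cs using Multiset.induction_on with
  | empty => exact (Set.finite_singleton 0).subset (by rintro _ ⟨σ, -, rfl⟩; rfl)
  | cons c cs ih =>
    refine (Set.Finite.image2 (· + ·) hT ih).subset ?_
    rintro _ ⟨τ, h, rfl⟩
    exact ⟨_, h c (by simp), _, ⟨τ, fun d hd => h d (by simp [hd]), rfl⟩, by simp⟩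

/-- The symbols and contexts of a meta-multiset occur in a meta-sequent. -/
def MetaMultiset.Within (N : MetaMultiset L α) (C : MetaSequent L α) : Prop :=
  (∀ ψ ∈ N.formulas, ∀ x, Sum.inl x ∈ ψ.vars →
    ∃ φ ∈ C.ant.formulas + C.suc.formulas, Sum.inl x ∈ φ.vars) ∧
  (∀ c ∈ N.contexts, c ∈ C.ant.contexts + C.suc.contexts ∨ ∃ b, (b, c) ∈ C.ant.boxed) ∧
  N.boxed = 0

/-- The symbols and contexts of the premises occur in the conclusion. -/
def Rule.Analytic (r : Rule L α) : Prop :=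
  ∀ M ∈ r.premises, M.ant.Within r.conclusion ∧ M.suc.Within r.conclusion

theorem MetaMultiset.inst_le_formulas (σ : ℕ → Formula L α) (τ : ℕ → Multiset (Formula L α))
    (N : MetaMultiset L α) : N.formulas.map (MetaFormula.inst σ) ≤ N.inst σ τ := by
  rw [MetaMultiset.inst, add_assoc]
  exact Multiset.le_add_right _ _

theorem MetaMultiset.inst_le_contexts (σ : ℕ → Formula L α) (τ : ℕ → Multiset (Formula L α))
    (N : MetaMultiset L α) {c : ℕ} (hc : c ∈ N.contexts) : τ c ≤ N.inst σ τ := by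
  rw [MetaMultiset.inst, add_right_comm]
  exact (Multiset.le_bind N.contexts hc).trans (Multiset.le_add_left _ _)

theorem MetaMultiset.inst_le_boxed (σ : ℕ → Formula L α) (τ : ℕ → Multiset (Formula L α))
    (N : MetaMultiset L α) {b c} (hc : (b, c) ∈ N.boxed) :
    (τ c).map (Formula.unary b) ≤ N.inst σ τ :=
  (Multiset.le_bind (f := fun b : _ × ℕ => (τ b.2).map (Formula.unary b.1)) N.boxed hc).trans
    (Multiset.le_add_left _ _)

/-- A symbol that occurs in the conclusion takes a subformula of `S` as its value. A context of the
conclusion takes formulas of `S`, possibly with a box removed, and no more of them than `S` has.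
Hence only finitely many values are relevant. -/
theorem MetaMultiset.finite_inst {N : MetaMultiset L α} {C : MetaSequent L α} (hN : N.Within C)
    (S : Sequent L α) : {m | ∃ σ τ, C.inst σ τ = S ∧ N.inst σ τ = m}.Finite := by
  classical
  set T : Set (Formula L α) := ⋃ φ ∈ (S.ant + S.suc).toFinset, φ.subs with hTdef
  have hT : T.Finite := Set.Finite.biUnion (Finset.finite_toSet _) fun φ _ => φ.finite_subs
  have hmem : ∀ φ ∈ S.ant + S.suc, ∀ ψ ∈ φ.subs, ψ ∈ T := fun φ hφ ψ hψ =>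
    Set.mem_biUnion (by simpa using hφ) hψ
  refine (Set.Finite.image2 (· + ·) (MetaFormula.finite_map_inst hT N.formulas)
    (finite_bind (finite_multisets hT (S.ant + S.suc).card) N.contexts)).subset ?_
  rintro _ ⟨σ, τ, hS, rfl⟩
  have hant : S.ant = C.ant.inst σ τ := by rw [← hS]; rfl
  have hsuc : S.suc = C.suc.inst σ τ := by rw [← hS]; rfl
  refine ⟨_, ⟨σ, ?_, rfl⟩, _, ⟨τ, ?_, rfl⟩, by simp [MetaMultiset.inst, hN.2.2]⟩
  · intro ψ hψ x hx
    obtain ⟨φ, hφ, hxφ⟩ := hN.1 ψ hψ x hx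
    refine hmem (φ.inst σ) ?_ _ (Formula.mem_subs_subst (Sum.elim σ Formula.atom) hxφ)
    rw [hant, hsuc]
    refine Multiset.mem_add.2 ((Multiset.mem_add.1 hφ).imp (fun h => ?_) fun h => ?_)
    · exact Multiset.mem_of_le (MetaMultiset.inst_le_formulas σ τ _) (Multiset.mem_map_of_mem _ h)
    · exact Multiset.mem_of_le (MetaMultiset.inst_le_formulas σ τ _) (Multiset.mem_map_of_mem _ h)
  · intro c hc
    rcases hN.2.1 c hc with h | ⟨b, h⟩
    · have hle : τ c ≤ S.ant + S.suc := by
        rw [hant, hsuc]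
        rcases Multiset.mem_add.1 h with h | h
        · exact (MetaMultiset.inst_le_contexts σ τ _ h).trans (Multiset.le_add_right _ _)
        · exact (MetaMultiset.inst_le_contexts σ τ _ h).trans (Multiset.le_add_left _ _)
      exact ⟨fun A hA => hmem A (Multiset.mem_of_le hle hA) A A.mem_subs_self,
        Multiset.card_le_card hle⟩
    · have hle : (τ c).map (Formula.unary b) ≤ S.ant + S.suc := by
        rw [hant]
        exact (MetaMultiset.inst_le_boxed σ τ _ h).trans (Multiset.le_add_right _ _)
      exact ⟨fun A hA => hmem _ (Multiset.mem_of_le hle (Multiset.mem_map_of_mem _ hA)) A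
        (Formula.mem_subs_unary b A), by simpa using Multiset.card_le_card hle⟩

/-- The premises of the rule instances with a given conclusion. -/
def Calculus.premisesOf (H : Calculus L α) (S : Sequent L α) : Set (Sequent L α) :=
  {S' | ∃ r ∈ H, ∃ σ τ, r.Admits σ τ ∧ r.conclusion.inst σ τ = S ∧
    ∃ M ∈ r.premises, M.inst σ τ = S'}

theorem Calculus.finite_premisesOf {H : Calculus L α} (hH : ∀ r ∈ H, r.Analytic)
    {S : Sequent L α} (hS : {r | r ∈ H ∧ r.BackwardApplicable S}.Finite) :
    (H.premisesOf S).Finite := by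
  classical
  refine (hS.biUnion (t := fun r => ⋃ M ∈ {M | r ∈ H ∧ M ∈ r.premises},
    {S' | ∃ σ τ, r.conclusion.inst σ τ = S ∧ M.inst σ τ = S'}) fun r hr => ?_).subset ?_
  · refine Set.Finite.biUnion (r.premises.toFinset.finite_toSet.subset fun M hM => ?_) ?_
    · simpa using hM.2
    · intro M hM
      obtain ⟨h₁, h₂⟩ := hH r hr.1 M hM.2
      refine (Set.Finite.image2 Sequent.mk (MetaMultiset.finite_inst h₁ S)
        (MetaMultiset.finite_inst h₂ S)).subset ?_
      rintro _ ⟨σ, τ, h, rfl⟩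
      exact ⟨_, ⟨σ, τ, h, rfl⟩, _, ⟨σ, τ, h, rfl⟩, rfl⟩
  · rintro _ ⟨r, hr, σ, τ, hA, hc, M, hM, rfl⟩
    exact Set.mem_biUnion (x := r) ⟨hr, σ, τ, hA, hc⟩
      (Set.mem_biUnion (x := M) ⟨hr, hM⟩ ⟨σ, τ, hc, rfl⟩)

end Premises

/-! ### Rule instances as steps whose contexts can be reassigned -/

section Steps

variable {L : Signature.{u}} {α : Type v}

/-- A premise scheme `Γ, ant ⇒ suc` with context `ctx = Γ`; if `suc = none`, then the succedent
is a context. -/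
structure Row (L : Signature.{u}) (α : Type v) where
  ctx : ℕ
  ant : Multiset (Formula L α)
  suc : Option (Multiset (Formula L α))

/-- The premise for a choice `s` of the contexts and `Δ` of the succedent context. -/
def Row.seq (ρ : Row L α) (s : ℕ → Multiset (Formula L α)) (Δ : Multiset (Formula L α)) :
    Sequent L α :=
  ⟨ρ.ant + s ρ.ctx, ρ.suc.getD Δ⟩

/-- All formulas of the row are `p`-free. -/
def Row.Free (p : α) (ρ : Row L α) : Prop :=
  (∀ A ∈ ρ.ant, A.Free p) ∧ ∀ Y ∈ ρ.suc, ∀ A ∈ Y, A.Free p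

/-- From `ρ.seq s Δ`, for all `ρ ∈ R`, the calculus infers `mL, s(l) ⇒ mR, Δ`, for all `s`
and `Δ`. One of `mL`, `mR` consists of the main formula and the other one is empty. -/
structure Calculus.IsStep (H : Calculus L α) (l : List ℕ) (R : Set (Row L α))
    (mL mR : Multiset (Formula L α)) : Prop where
  nodup : l.Nodup
  ctx_mem : ∀ ρ ∈ R, ρ.ctx ∈ l
  main : (∃ φ, mL = {φ} ∧ mR = 0) ∨ (∃ φ, mL = 0 ∧ mR = {φ})
  free : ∀ p : α, (∀ A ∈ mL, A.Free p) → (∀ A ∈ mR, A.Free p) → ∀ ρ ∈ R, ρ.Free p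
  inst : ∀ s Δ, (mR + Δ).card ≤ 1 → ∃ r ∈ H, ∃ σ τ, r.Admits σ τ ∧
    r.conclusion.inst σ τ = ⟨mL + (l.map s).sum, mR + Δ⟩ ∧
    ∀ S', (∃ M ∈ r.premises, M.inst σ τ = S') ↔ ∃ ρ ∈ R, ρ.seq s Δ = S'

/-- The instance of the rule is a step. -/
def Rule.IsStepInstance (H : Calculus L α) (r : Rule L α) (σ : ℕ → Formula L α)
    (τ : ℕ → Multiset (Formula L α)) : Prop :=
  ∃ l R mL mR Δ, H.IsStep l R mL mR ∧ (mR + Δ).card ≤ 1 ∧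
    r.conclusion.inst σ τ = ⟨mL + (l.map τ).sum, mR + Δ⟩ ∧
    ∀ ρ ∈ R, ∃ M ∈ r.premises, M.inst σ τ = ρ.seq τ Δ

namespace Calculus.IsStep

variable {H : Calculus L α} {l : List ℕ} {R : Set (Row L α)} {mL mR : Multiset (Formula L α)}

theorem derivable (hs : H.IsStep l R mL mR) {s : ℕ → Multiset (Formula L α)}
    {Δ : Multiset (Formula L α)} (hΔ : (mR + Δ).card ≤ 1)
    (h : ∀ ρ ∈ R, H.Derivable (ρ.seq s Δ)) :
    H.Derivable ⟨mL + (l.map s).sum, mR + Δ⟩ := by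
  obtain ⟨r, hr, σ, τ, hA, hc, hp⟩ := hs.inst s Δ hΔ
  rw [← hc]
  refine .step r hr σ τ hA fun M hM => ?_
  obtain ⟨ρ, hρ, h'⟩ := (hp _).1 ⟨M, hM, rfl⟩
  exact h' ▸ h ρ hρ

theorem seq_mem_premisesOf (hs : H.IsStep l R mL mR) {s : ℕ → Multiset (Formula L α)}
    {Δ : Multiset (Formula L α)} (hΔ : (mR + Δ).card ≤ 1) {ρ : Row L α} (hρ : ρ ∈ R) :
    ρ.seq s Δ ∈ H.premisesOf ⟨mL + (l.map s).sum, mR + Δ⟩ := by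
  obtain ⟨r, hr, σ, τ, hA, hc, hp⟩ := hs.inst s Δ hΔ
  exact ⟨r, hr, σ, τ, hA, hc, (hp _).2 ⟨ρ, hρ, rfl⟩⟩

end Calculus.IsStep

/-- At most one succedent context of a single-conclusion instance is nonempty. If all are empty,
some index must still be chosen, which is why the list must not be empty. -/
theorem exists_support {β : Type*} {τ : ℕ → Multiset β} {l : List ℕ} (hl : l ≠ [])
    (h : (l.map τ).sum.card ≤ 1) : ∃ i ∈ l, (∀ d ∈ l, d ≠ i → τ d = 0) := by
  induction l with
  | nil => exact absurd rfl hl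
  | cons d l ih =>
    simp only [List.map_cons, List.sum_cons, Multiset.card_add] at h
    by_cases hd : τ d = 0
    · by_cases hl' : l = []
      · subst hl'
        exact ⟨d, by simp, by simp⟩
      · obtain ⟨i, hi, hi'⟩ := ih hl' (by omega)
        exact ⟨i, by simp [hi], fun e he hei => (List.mem_cons.1 he).elim (fun h => h ▸ hd)
          fun he => hi' e he hei⟩
    · refine ⟨d, by simp, fun e he hed => ?_⟩
      have h0 : (l.map τ).sum = 0 := by
        have := Multiset.card_pos.2 hd
        exact Multiset.card_eq_zero.1 (by omega)
      exact Multiset.le_zero.1 (h0 ▸ mem_sum_map ((List.mem_cons.1 he).resolve_left hed))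

theorem sum_eq_of_support {β : Type*} {τ : ℕ → Multiset β} {l : List ℕ} (hl : l.Nodup) {i : ℕ}
    (hi : i ∈ l) (h : ∀ d ∈ l, d ≠ i → τ d = 0) : (l.map τ).sum = τ i := by
  rw [← List.sum_toFinset τ hl]
  exact Finset.sum_eq_single i (fun d hd => h d (by simpa using hd)) fun h => absurd (by simpa) h

theorem ClosedBlock.inst_of_mem {b : ClosedBlock L α} {M : MetaSequent L α}
    (σ : ℕ → Formula L α) (τ : ℕ → Multiset (Formula L α)) (h : M ∈ b.premises) :
    ∃ x ∈ b.rows, M.inst σ τ =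
      ⟨x.1.map (MetaFormula.inst σ) + τ b.ctx, x.2.map (MetaFormula.inst σ)⟩ := by
  obtain ⟨x, hx, rfl⟩ := List.mem_map.1 h
  exact ⟨x, hx, by simp [MetaSequent.inst, MetaMultiset.inst]⟩

theorem ClosedBlock.exists_premise {b : ClosedBlock L α} {x} (σ : ℕ → Formula L α)
    (τ : ℕ → Multiset (Formula L α)) (h : x ∈ b.rows) :
    ∃ M ∈ b.premises, M.inst σ τ =
      ⟨x.1.map (MetaFormula.inst σ) + τ b.ctx, x.2.map (MetaFormula.inst σ)⟩ :=
  ⟨_, List.mem_map.2 ⟨x, h, rfl⟩, by simp [MetaSequent.inst, MetaMultiset.inst]⟩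

theorem OpenBlock.inst_of_mem {b : OpenBlock L α} {M : MetaSequent L α}
    (σ : ℕ → Formula L α) (τ : ℕ → Multiset (Formula L α)) (h : M ∈ b.premises) :
    ∃ x ∈ b.rows, M.inst σ τ = ⟨x.map (MetaFormula.inst σ) + τ b.ctx, τ b.sucCtx⟩ := by
  obtain ⟨x, hx, rfl⟩ := List.mem_map.1 h
  exact ⟨x, hx, by simp [MetaSequent.inst, MetaMultiset.inst]⟩

theorem OpenBlock.exists_premise {b : OpenBlock L α} {x} (σ : ℕ → Formula L α)
    (τ : ℕ → Multiset (Formula L α)) (h : x ∈ b.rows) :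
    ∃ M ∈ b.premises, M.inst σ τ = ⟨x.map (MetaFormula.inst σ) + τ b.ctx, τ b.sucCtx⟩ :=
  ⟨_, List.mem_map.2 ⟨x, h, rfl⟩, by simp [MetaSequent.inst, MetaMultiset.inst]⟩

/-- The common form of the left semi-analytic and the context-sharing semi-analytic rules. -/
structure Rule.IsLeftForm (r : Rule L α) (P : List (ClosedBlock L α)) (B : List (OpenBlock L α))
    (φ : MetaFormula L α) (l : List ℕ) : Prop where
  ne_nil : B ≠ []
  nodup : (l ++ B.map (·.sucCtx)).Nodup
  closed_ctx : ∀ b ∈ P, b.ctx ∈ l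
  open_ctx : ∀ b ∈ B, b.ctx ∈ l
  closed_vars : ∀ b ∈ P, b.VarsIn φ.vars
  open_vars : ∀ b ∈ B, b.VarsIn φ.vars
  premises : r.premises = ↑(P.flatMap ClosedBlock.premises ++ B.flatMap OpenBlock.premises)
  conclusion : r.conclusion =
    ⟨{ formulas := {φ}, contexts := ↑l }, { contexts := ↑(B.map (·.sucCtx)) }⟩

theorem Rule.IsLeftSemiAnalytic.isLeftForm {r : Rule L α} (h : r.IsLeftSemiAnalytic) :
    ∃ P B φ l, r.IsLeftForm P B φ l := by
  obtain ⟨P, B, φ, hB, hnd, hP, hB', hp, hc⟩ := h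
  refine ⟨P, B, φ, _, hB, hnd, ?_, ?_, hP, hB', hp, hc⟩
  · exact fun b hb => List.mem_append_left _ (List.mem_map_of_mem hb)
  · exact fun b hb => List.mem_append_right _ (List.mem_map_of_mem (f := (·.ctx)) hb)

theorem Rule.IsContextSharingSemiAnalytic.isLeftForm {r : Rule L α}
    (h : r.IsContextSharingSemiAnalytic) : ∃ P B φ l, r.IsLeftForm P B φ l := by
  obtain ⟨B, φ, hB, hnd, hv, hp, hc⟩ := h
  have hs : (B.map SharedBlock.openPart).map (·.sucCtx) = B.map (·.sucCtx) := by
    simp [SharedBlock.openPart, Function.comp_def]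
  refine ⟨B.map SharedBlock.closedPart, B.map SharedBlock.openPart, φ, B.map (·.ctx), by simpa,
    by rwa [hs], ?_, ?_, ?_, ?_, ?_, ?_⟩
  · simp only [List.mem_map, forall_exists_index, and_imp, forall_apply_eq_imp_iff₂]
    exact fun b hb => ⟨b, hb, rfl⟩
  · simp only [List.mem_map, forall_exists_index, and_imp, forall_apply_eq_imp_iff₂]
    exact fun b hb => ⟨b, hb, rfl⟩
  · simpa using fun b hb => (hv b hb).1
  · simpa using fun b hb => (hv b hb).2
  · rw [hp, List.flatMap_map, List.flatMap_map]
  · rw [hc, hs]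

namespace Rule.IsLeftForm

variable {H : Calculus L α} {r : Rule L α} {P : List (ClosedBlock L α)}
  {B : List (OpenBlock L α)} {φ : MetaFormula L α} {l : List ℕ}

theorem mem_premises (h : r.IsLeftForm P B φ l) {M : MetaSequent L α} :
    M ∈ r.premises ↔ (∃ b ∈ P, M ∈ b.premises) ∨ ∃ b ∈ B, M ∈ b.premises := by
  simp [h.premises]

/-- The rows of the instance if the succedent of the conclusion is the value of the context `i`. -/
def rows (P : List (ClosedBlock L α)) (B : List (OpenBlock L α)) (σ : ℕ → Formula L α) (i : ℕ) :
    Set (Row L α) :=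
  {ρ | (∃ b ∈ P, ∃ x ∈ b.rows,
      ρ = ⟨b.ctx, x.1.map (MetaFormula.inst σ), some (x.2.map (MetaFormula.inst σ))⟩) ∨
    ∃ b ∈ B, ∃ x ∈ b.rows,
      ρ = ⟨b.ctx, x.map (MetaFormula.inst σ), if b.sucCtx = i then none else some 0⟩}

theorem premises_iff (h : r.IsLeftForm P B φ l) {σ : ℕ → Formula L α} {i : ℕ}
    {τ s : ℕ → Multiset (Formula L α)} (hs : ∀ c ∈ l, τ c = s c)
    (hi : ∀ b ∈ B, b.sucCtx ≠ i → τ b.sucCtx = 0) (S' : Sequent L α) :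
    (∃ M ∈ r.premises, M.inst σ τ = S') ↔ ∃ ρ ∈ rows P B σ i, ρ.seq s (τ i) = S' := by
  constructor
  · rintro ⟨M, hM, rfl⟩
    rcases h.mem_premises.1 hM with ⟨b, hb, hM⟩ | ⟨b, hb, hM⟩
    · obtain ⟨x, hx, h'⟩ := b.inst_of_mem σ τ hM
      refine ⟨_, Or.inl ⟨b, hb, x, hx, rfl⟩, ?_⟩
      rw [h', hs _ (h.closed_ctx b hb)]
      rfl
    · obtain ⟨x, hx, h'⟩ := b.inst_of_mem σ τ hM
      refine ⟨_, Or.inr ⟨b, hb, x, hx, rfl⟩, ?_⟩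
      rw [h', hs _ (h.open_ctx b hb)]
      by_cases hbi : b.sucCtx = i
      · simp [Row.seq, hbi]
      · simp [Row.seq, hbi, hi b hb hbi]
  · rintro ⟨ρ, ⟨b, hb, x, hx, rfl⟩ | ⟨b, hb, x, hx, rfl⟩, rfl⟩
    · obtain ⟨M, hM, h'⟩ := b.exists_premise σ τ hx
      refine ⟨M, h.mem_premises.2 (Or.inl ⟨b, hb, hM⟩), ?_⟩
      rw [h', hs _ (h.closed_ctx b hb)]
      rfl
    · obtain ⟨M, hM, h'⟩ := b.exists_premise σ τ hx
      refine ⟨M, h.mem_premises.2 (Or.inr ⟨b, hb, hM⟩), ?_⟩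
      rw [h', hs _ (h.open_ctx b hb)]
      by_cases hbi : b.sucCtx = i
      · simp [Row.seq, hbi]
      · simp [Row.seq, hbi, hi b hb hbi]

theorem conclusion_inst (h : r.IsLeftForm P B φ l) {σ : ℕ → Formula L α} {i : ℕ}
    {τ s : ℕ → Multiset (Formula L α)} (hs : ∀ c ∈ l, τ c = s c)
    (hiB : i ∈ B.map (·.sucCtx)) (hi : ∀ b ∈ B, b.sucCtx ≠ i → τ b.sucCtx = 0) :
    r.conclusion.inst σ τ = ⟨{φ.inst σ} + (l.map s).sum, 0 + τ i⟩ := by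
  have h₁ : (l.map τ).sum = (l.map s).sum := by rw [List.map_congr_left hs]
  have h₂ : ((B.map (·.sucCtx)).map τ).sum = τ i := by
    refine sum_eq_of_support h.nodup.of_append_right hiB fun d hd hdi => ?_
    obtain ⟨b, hb, rfl⟩ := List.mem_map.1 hd
    exact hi b hb hdi
  rw [h.conclusion]
  simp only [MetaSequent.inst, MetaMultiset.inst, coe_bind_eq_sum, h₁, h₂]
  simp [MetaFormula.inst]

/-- With `σ` and the succedent-carrying context `i` fixed, the main and side formulas are fixed,
while the contexts remain free. -/
theorem isStep (hr : r ∈ H) (h : r.IsLeftForm P B φ l) {σ : ℕ → Formula L α}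
    {τ : ℕ → Multiset (Formula L α)} (hA : r.Admits σ τ) {i : ℕ} (hiB : i ∈ B.map (·.sucCtx)) :
    H.IsStep l (rows P B σ i) {φ.inst σ} 0 where
  nodup := h.nodup.of_append_left
  ctx_mem := by
    rintro ρ (⟨b, hb, x, hx, rfl⟩ | ⟨b, hb, x, hx, rfl⟩)
    exacts [h.closed_ctx b hb, h.open_ctx b hb]
  main := Or.inl ⟨_, rfl, rfl⟩
  free p hL _ := by
    have hφ := hL _ (Multiset.mem_singleton_self _)
    rintro ρ (⟨b, hb, x, hx, rfl⟩ | ⟨b, hb, x, hx, rfl⟩)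
    · obtain ⟨h₁, h₂⟩ := h.closed_vars b hb x hx
      refine ⟨fun A hA => ?_, fun Y hY A hA => ?_⟩
      · obtain ⟨ψ, hψ, rfl⟩ := Multiset.mem_map.1 hA
        exact MetaFormula.free_of_vars_subset (h₁ ψ hψ) hφ
      · obtain rfl := Option.mem_some_iff.1 hY
        obtain ⟨ψ, hψ, rfl⟩ := Multiset.mem_map.1 hA
        exact MetaFormula.free_of_vars_subset (h₂ ψ hψ) hφ
    · refine ⟨fun A hA => ?_, fun Y hY A hA => ?_⟩
      · obtain ⟨ψ, hψ, rfl⟩ := Multiset.mem_map.1 hA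
        exact MetaFormula.free_of_vars_subset (h.open_vars b hb x hx ψ hψ) hφ
      · dsimp only at hY
        split_ifs at hY
        · simp at hY
        · obtain rfl := Option.mem_some_iff.1 hY
          simp at hA
  inst s Δ hΔ := by
    classical
    -- All succedent contexts other than `i` are emptied; distinctness of the contexts makes this
    -- compatible with `s`.
    set τ' : ℕ → Multiset (Formula L α) :=
      fun c => if c ∈ l then s c else if c = i then Δ else 0 with hτ'
    have hs : ∀ c ∈ l, τ' c = s c := fun c hc => by simp [hτ', hc]
    have hdisj : ∀ d ∈ B.map (·.sucCtx), d ∉ l := fun d hd hd' =>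
      (List.disjoint_of_nodup_append h.nodup) hd' hd
    have hi : τ' i = Δ := by simp [hτ', hdisj i hiB]
    have hi0 : ∀ b ∈ B, b.sucCtx ≠ i → τ' b.sucCtx = 0 := fun b hb hbi => by
      simp [hτ', hdisj _ (List.mem_map_of_mem (f := (·.sucCtx)) hb), hbi]
    have hc := h.conclusion_inst (σ := σ) hs hiB hi0
    rw [hi] at hc
    refine ⟨r, hr, σ, τ', ⟨by rw [hc]; exact hΔ, fun M hM => ?_⟩, hc, fun S' => ?_⟩
    · rcases h.mem_premises.1 hM with ⟨b, hb, hM'⟩ | ⟨b, hb, hM'⟩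
      · obtain ⟨x, hx, rfl⟩ := List.mem_map.1 hM'
        -- The succedent of a closed premise does not involve the contexts, so its bound carries
        -- over from the given instance.
        have := hA.2 _ hM
        simpa [Sequent.Single, MetaSequent.inst, MetaMultiset.inst] using this
      · obtain ⟨x, hx, h'⟩ := b.inst_of_mem σ τ' hM'
        rw [h']
        by_cases hbi : b.sucCtx = i
        · simpa [Sequent.Single, hbi, hi] using hΔ
        · simp [Sequent.Single, hi0 b hb hbi]
    · rw [h.premises_iff hs hi0, hi]

theorem isStepInstance (hr : r ∈ H) (h : r.IsLeftForm P B φ l) {σ : ℕ → Formula L α}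
    {τ : ℕ → Multiset (Formula L α)} (hA : r.Admits σ τ) : r.IsStepInstance H σ τ := by
  have hcard : ((B.map (·.sucCtx)).map τ).sum.card ≤ 1 := by
    have := hA.1
    rw [h.conclusion] at this
    simpa only [Sequent.Single, MetaSequent.inst, MetaMultiset.inst, coe_bind_eq_sum,
      Multiset.map_zero, Multiset.zero_bind, zero_add, add_zero] using this
  obtain ⟨i, hiB, hi⟩ := exists_support (by simpa using h.ne_nil) hcard
  have hi0 : ∀ b ∈ B, b.sucCtx ≠ i → τ b.sucCtx = 0 := fun b hb =>
    hi _ (List.mem_map_of_mem (f := (·.sucCtx)) hb)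
  have hc := h.conclusion_inst (σ := σ) (τ := τ) (fun c _ => rfl) hiB hi0
  refine ⟨l, _, _, 0, τ i, h.isStep hr hA hiB, ?_, hc, fun ρ hρ => ?_⟩
  · have := hA.1
    rwa [hc] at this
  · exact (h.premises_iff (fun c _ => rfl) hi0 _).2 ⟨ρ, hρ, rfl⟩

theorem analytic (h : r.IsLeftForm P B φ l) : r.Analytic := by
  intro M hM
  rw [h.conclusion]
  rcases h.mem_premises.1 hM with ⟨b, hb, hM⟩ | ⟨b, hb, hM⟩ <;>
    obtain ⟨x, hx, rfl⟩ := List.mem_map.1 hM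
  · obtain ⟨h₁, h₂⟩ := h.closed_vars b hb x hx
    refine ⟨⟨fun ψ hψ y hy => ⟨φ, by simp, h₁ ψ hψ hy⟩, fun c hc => Or.inl ?_, rfl⟩,
      ⟨fun ψ hψ y hy => ⟨φ, by simp, h₂ ψ hψ hy⟩, fun c hc => Or.inl ?_, rfl⟩⟩
    · obtain rfl := Multiset.mem_singleton.1 hc
      simp [h.closed_ctx b hb]
    · simp at hc
  · refine ⟨⟨fun ψ hψ y hy => ⟨φ, by simp, h.open_vars b hb x hx ψ hψ hy⟩,
      fun c hc => Or.inl ?_, rfl⟩, ⟨fun ψ hψ => by simp at hψ, fun c hc => Or.inl ?_, rfl⟩⟩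
    · obtain rfl := Multiset.mem_singleton.1 hc
      simp [h.open_ctx b hb]
    · obtain rfl := Multiset.mem_singleton.1 hc
      exact Multiset.mem_add.2 (Or.inr (List.mem_map_of_mem (f := (·.sucCtx)) hb))

end Rule.IsLeftForm

theorem Rule.IsRightSemiAnalytic.analytic {r : Rule L α} (h : r.IsRightSemiAnalytic) :
    r.Analytic := by
  obtain ⟨P, φ, -, hv, hp, hc⟩ := h
  intro M hM
  rw [hp, Multiset.mem_coe, List.mem_flatMap] at hM
  obtain ⟨b, hb, hM⟩ := hM
  obtain ⟨x, hx, rfl⟩ := List.mem_map.1 hM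
  obtain ⟨h₁, h₂⟩ := hv b hb x hx
  rw [hc]
  refine ⟨⟨fun ψ hψ y hy => ⟨φ, by simp, h₁ ψ hψ hy⟩, fun c hc => Or.inl ?_, rfl⟩,
    ⟨fun ψ hψ y hy => ⟨φ, by simp, h₂ ψ hψ hy⟩, fun c hc => Or.inl ?_, rfl⟩⟩
  · obtain rfl := Multiset.mem_singleton.1 hc
    exact Multiset.mem_add.2 (Or.inl (List.mem_map_of_mem (f := (·.ctx)) hb))
  · simp at hc

theorem Rule.IsRightSemiAnalytic.isStepInstance {H : Calculus L α} {r : Rule L α} (hr : r ∈ H)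
    (h : r.IsRightSemiAnalytic) {σ : ℕ → Formula L α} {τ : ℕ → Multiset (Formula L α)}
    (hA : r.Admits σ τ) : r.IsStepInstance H σ τ := by
  obtain ⟨P, φ, hnd, hv, hp, hc⟩ := h
  set R : Set (Row L α) := {ρ | ∃ b ∈ P, ∃ x ∈ b.rows,
      ρ = ⟨b.ctx, x.1.map (MetaFormula.inst σ), some (x.2.map (MetaFormula.inst σ))⟩} with hR
  have hmem : ∀ M, M ∈ r.premises ↔ ∃ b ∈ P, M ∈ b.premises := fun M => by simp [hp]
  have hiff : ∀ (s : ℕ → Multiset (Formula L α)) (Δ : Multiset (Formula L α)) S',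
      (∃ M ∈ r.premises, M.inst σ s = S') ↔ ∃ ρ ∈ R, ρ.seq s Δ = S' := by
    intro s Δ S'
    constructor
    · rintro ⟨M, hM, rfl⟩
      obtain ⟨b, hb, hM⟩ := (hmem M).1 hM
      obtain ⟨x, hx, h'⟩ := b.inst_of_mem σ s hM
      exact ⟨_, ⟨b, hb, x, hx, rfl⟩, by rw [h']; rfl⟩
    · rintro ⟨ρ, ⟨b, hb, x, hx, rfl⟩, rfl⟩
      obtain ⟨M, hM, h'⟩ := b.exists_premise σ s hx
      exact ⟨M, (hmem M).2 ⟨b, hb, hM⟩, by rw [h']; rfl⟩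
  have hconc : ∀ s : ℕ → Multiset (Formula L α), r.conclusion.inst σ s =
      ⟨0 + ((P.map (·.ctx)).map s).sum, {φ.inst σ} + 0⟩ := fun s => by
    rw [hc]
    simp only [MetaSequent.inst, MetaMultiset.inst, coe_bind_eq_sum]
    simp [MetaFormula.inst]
  refine ⟨P.map (·.ctx), R, 0, {φ.inst σ}, 0, ⟨hnd, ?_, Or.inr ⟨_, rfl, rfl⟩, ?_, ?_⟩, by simp,
    hconc τ, fun ρ hρ => (hiff τ 0 _).2 ⟨ρ, hρ, rfl⟩⟩
  · rintro ρ ⟨b, hb, x, hx, rfl⟩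
    exact List.mem_map_of_mem (f := (·.ctx)) hb
  · rintro p - hφ ρ ⟨b, hb, x, hx, rfl⟩
    replace hφ := hφ _ (Multiset.mem_singleton_self _)
    obtain ⟨h₁, h₂⟩ := hv b hb x hx
    refine ⟨fun A hA => ?_, fun Y hY A hA => ?_⟩
    · obtain ⟨ψ, hψ, rfl⟩ := Multiset.mem_map.1 hA
      exact MetaFormula.free_of_vars_subset (h₁ ψ hψ) hφ
    · obtain rfl := Option.mem_some_iff.1 hY
      obtain ⟨ψ, hψ, rfl⟩ := Multiset.mem_map.1 hA
      exact MetaFormula.free_of_vars_subset (h₂ ψ hψ) hφ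
  · intro s Δ hΔ
    obtain rfl : Δ = 0 := by
      rw [Multiset.card_add, Multiset.card_singleton] at hΔ
      exact Multiset.card_eq_zero.1 (by omega)
    refine ⟨r, hr, σ, s, ⟨by rw [hconc]; exact hΔ, fun M hM => ?_⟩, hconc s, hiff s 0⟩
    obtain ⟨b, hb, hM'⟩ := (hmem M).1 hM
    obtain ⟨x, hx, rfl⟩ := List.mem_map.1 hM'
    have := hA.2 _ hM
    simpa [Sequent.Single, MetaSequent.inst, MetaMultiset.inst] using this

/-! ### Modal rules -/

/-- The rule `K` is present for the unary connective `b`. -/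
def Calculus.HasK (H : Calculus L α) (b : {c : L.Conn // L.arity c = 1}) : Prop :=
  ∃ r ∈ H, ∃ Γ x : ℕ,
    r.premises = {⟨{ contexts := {Γ} }, { formulas := {Formula.atom (Sum.inl x)} }⟩} ∧
    r.conclusion = ⟨{ boxed := {(b, Γ)} },
      { formulas := {Formula.unary b (Formula.atom (Sum.inl x))} }⟩

theorem Calculus.HasK.derivable {H : Calculus L α} {b : {c : L.Conn // L.arity c = 1}}
    (h : H.HasK b) {Γ : Multiset (Formula L α)} {A : Formula L α} (hd : H.Derivable ⟨Γ, {A}⟩) :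
    H.Derivable ⟨Γ.map (Formula.unary b), {Formula.unary b A}⟩ := by
  obtain ⟨r, hr, c, x, hp, hc⟩ := h
  have h₁ : r.conclusion.inst (fun _ => A) (fun _ => Γ) =
      ⟨Γ.map (Formula.unary b), {Formula.unary b A}⟩ := by
    rw [hc]
    simp [MetaSequent.inst, MetaMultiset.inst, MetaFormula.inst, Formula.unary, Formula.subst]
  have h₂ : ∀ M ∈ r.premises, M.inst (fun _ => A) (fun _ => Γ) = ⟨Γ, {A}⟩ := by
    rw [hp]
    simp [MetaSequent.inst, MetaMultiset.inst, MetaFormula.inst, Formula.subst]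
  rw [← h₁]
  refine .step r hr _ _ ⟨by rw [h₁]; simp [Sequent.Single], fun M hM => ?_⟩ fun M hM => ?_
  · rw [h₂ M hM]; simp [Sequent.Single]
  · rwa [h₂ M hM]

theorem Rule.IsModalK.hasK {H : Calculus L α} {r : Rule L α} (hr : r ∈ H) (h : r.IsModalK)
    {b : {c : L.Conn // L.arity c = 1}} (hb : b ∈ L.box) : H.HasK b := by
  obtain ⟨b', hb', c, x, hp, hc⟩ := h
  obtain rfl := Option.mem_unique hb hb'
  exact ⟨r, hr, c, x, hp, hc⟩

theorem Rule.IsModalK.exists_inst {r : Rule L α} (h : r.IsModalK) (σ : ℕ → Formula L α)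
    (τ : ℕ → Multiset (Formula L α)) : ∃ b ∈ L.box, ∃ Γ A, ∃ M ∈ r.premises,
      M.inst σ τ = ⟨Γ, {A}⟩ ∧
      r.conclusion.inst σ τ = ⟨Γ.map (Formula.unary b), {Formula.unary b A}⟩ := by
  obtain ⟨b, hb, c, x, hp, hc⟩ := h
  refine ⟨b, hb, τ c, σ x, _, by rw [hp]; exact Multiset.mem_singleton_self _, ?_, ?_⟩
  · simp [MetaSequent.inst, MetaMultiset.inst, MetaFormula.inst, Formula.subst]
  · rw [hc]
    simp [MetaSequent.inst, MetaMultiset.inst, MetaFormula.inst, Formula.unary, Formula.subst]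

theorem Rule.IsModalD.exists_inst {H : Calculus L α} {r : Rule L α} (hr : r ∈ H) (h : r.IsModalD)
    (σ : ℕ → Formula L α) (τ : ℕ → Multiset (Formula L α)) : ∃ b ∈ L.box,
      (∀ Γ, H.Derivable ⟨Γ, 0⟩ → H.Derivable ⟨Γ.map (Formula.unary b), 0⟩) ∧
      ∃ Γ, ∃ M ∈ r.premises, M.inst σ τ = ⟨Γ, 0⟩ ∧
        r.conclusion.inst σ τ = ⟨Γ.map (Formula.unary b), 0⟩ := by
  obtain ⟨b, hb, c, hp, hc⟩ := h
  have h₁ : ∀ τ, r.conclusion.inst σ τ = ⟨(τ c).map (Formula.unary b), 0⟩ := fun τ => by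
    rw [hc]
    simp [MetaSequent.inst, MetaMultiset.inst]
  have h₂ : ∀ τ, ∀ M ∈ r.premises, M.inst σ τ = ⟨τ c, 0⟩ := fun τ => by
    rw [hp]
    simp [MetaSequent.inst, MetaMultiset.inst]
  have hM : ⟨{ contexts := {c} }, {}⟩ ∈ r.premises := by
    rw [hp]; exact Multiset.mem_singleton_self _
  refine ⟨b, hb, fun Γ hd => ?_, τ c, _, hM, h₂ τ _ hM, h₁ τ⟩
  rw [← h₁ fun _ => Γ]
  refine .step r hr _ _ ⟨by rw [h₁]; simp [Sequent.Single], fun M hM => ?_⟩ fun M hM => ?_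
  · rw [h₂ _ M hM]; simp [Sequent.Single]
  · rwa [h₂ _ M hM]

/-- Both modal rules box a whole sequent, with a singleton succedent for `K` and an empty one for
`D`, so they can be treated alike. -/
theorem Rule.exists_modal_inst {H : Calculus L α} {r : Rule L α} (hr : r ∈ H)
    (h : r.IsModalK ∨ r.IsModalD) (σ : ℕ → Formula L α) (τ : ℕ → Multiset (Formula L α))
    (hK : ∀ b ∈ L.box, H.HasK b) : ∃ b ∈ L.box, ∃ Γ Δ,
      (∀ Γ', H.Derivable ⟨Γ', Δ⟩ →
        H.Derivable ⟨Γ'.map (Formula.unary b), Δ.map (Formula.unary b)⟩) ∧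
      ∃ M ∈ r.premises, M.inst σ τ = ⟨Γ, Δ⟩ ∧
        r.conclusion.inst σ τ = ⟨Γ.map (Formula.unary b), Δ.map (Formula.unary b)⟩ := by
  rcases h with h | h
  · obtain ⟨b, hb, Γ, A, M, hM, h₁, h₂⟩ := h.exists_inst σ τ
    exact ⟨b, hb, Γ, {A}, fun Γ' hd => (hK b hb).derivable hd, M, hM, h₁, h₂⟩
  · obtain ⟨b, hb, hd, Γ, M, hM, h₁, h₂⟩ := h.exists_inst hr σ τ
    exact ⟨b, hb, Γ, 0, hd, M, hM, h₁, h₂⟩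

theorem Rule.IsModalK.analytic {r : Rule L α} (h : r.IsModalK) : r.Analytic := by
  obtain ⟨b, -, c, x, hp, hc⟩ := h
  intro M hM
  rw [hp, Multiset.mem_singleton] at hM
  subst hM
  rw [hc]
  refine ⟨⟨by simp, fun d hd => Or.inr ⟨b, ?_⟩, rfl⟩, ⟨fun ψ hψ y hy => ?_, by simp, rfl⟩⟩
  · obtain rfl := Multiset.mem_singleton.1 hd
    simp
  · obtain rfl := Multiset.mem_singleton.1 hψ
    refine ⟨Formula.unary b (Formula.atom (Sum.inl x)), by simp, ?_⟩
    exact Set.mem_iUnion.2 ⟨⟨0, by simp [b.2]⟩, hy⟩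

theorem Rule.IsModalD.analytic {r : Rule L α} (h : r.IsModalD) : r.Analytic := by
  obtain ⟨b, -, c, hp, hc⟩ := h
  intro M hM
  rw [hp, Multiset.mem_singleton] at hM
  subst hM
  rw [hc]
  refine ⟨⟨by simp, fun d hd => Or.inr ⟨b, ?_⟩, rfl⟩, ⟨by simp, by simp, rfl⟩⟩
  obtain rfl := Multiset.mem_singleton.1 hd
  simp

/-! ### Focused axioms -/

/-- Whether `p` occurs in an instance of a meta-formula depends only on the variables of the
meta-formula, given `σ`. -/
theorem SameVars.free_or_not_free {F : Multiset (MetaFormula L α)} (hF : SameVars F)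
    (σ : ℕ → Formula L α) (p : α) : (∀ A ∈ F.map (MetaFormula.inst σ), A.Free p) ∨
      ∀ A ∈ F.map (MetaFormula.inst σ), ¬ A.Free p := by
  simp only [Multiset.mem_map, forall_exists_index, and_imp, forall_apply_eq_imp_iff₂]
  by_contra! h
  obtain ⟨⟨φ, hφ, h₁⟩, ψ, hψ, h₂⟩ := h
  exact h₁ (MetaFormula.free_of_vars_subset (hF φ hφ ψ hψ).le h₂)

/-- Emptying the contexts of an axiom gives another instance of it. Apart from identities, an axiom
thus holds because of its succedent alone or because of an inconsistent part of its antecedent, and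
focusing prevents that part from mixing `p`-free formulas with others. -/
theorem Rule.IsFocusedAxiom.cases {H : Calculus L α} {r : Rule L α} (hr : r ∈ H)
    (h : r.IsFocusedAxiom) {σ : ℕ → Formula L α} {τ : ℕ → Multiset (Formula L α)}
    (hA : r.Admits σ τ) (p : α) :
    (∃ A, r.conclusion.inst σ τ = ⟨{A}, {A}⟩) ∨
    H.Derivable ⟨0, (r.conclusion.inst σ τ).suc⟩ ∨
    ∃ N ≤ (r.conclusion.inst σ τ).ant, ((∀ A ∈ N, A.Free p) ∨ ∀ A ∈ N, ¬ A.Free p) ∧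
      H.Derivable ⟨N, 0⟩ := by
  obtain ⟨hp, h⟩ := h
  have hder : ∀ τ S, r.conclusion.inst σ τ = S → S.Single → H.Derivable S := by
    rintro τ _ rfl hS
    exact .step r hr σ τ ⟨hS, by simp [hp]⟩ (by simp [hp])
  have hS := hA.1
  rcases h with ⟨φ, hc⟩ | ⟨F, hF, hc⟩ | ⟨F, hF, hc⟩ | ⟨F, c, d, hF, hcd, hc⟩ | ⟨F, c, d, hF, hcd, hc⟩
  · refine Or.inl ⟨φ.inst σ, ?_⟩
    rw [hc]
    simp [MetaSequent.inst, MetaMultiset.inst, MetaFormula.inst]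
  · refine Or.inr (Or.inl (hder τ _ ?_ hS))
    rw [hc]
    simp [MetaSequent.inst, MetaMultiset.inst]
  · refine Or.inr (Or.inr ⟨_, ?_, hF.free_or_not_free σ p, hder τ _ ?_ (by simp [Sequent.Single])⟩)
    · rw [hc]; exact MetaMultiset.inst_le_formulas σ τ _
    · rw [hc]; simp [MetaSequent.inst, MetaMultiset.inst]
  · refine Or.inr (Or.inr ⟨_, ?_, hF.free_or_not_free σ p,
      hder 0 _ ?_ (by simp [Sequent.Single])⟩)
    · rw [hc]; exact MetaMultiset.inst_le_formulas σ τ _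
    · rw [hc]; simp [MetaSequent.inst, MetaMultiset.inst]
  · refine Or.inr (Or.inl (hder (Function.update τ c 0) _ ?_ hS))
    rw [hc]
    simp [MetaSequent.inst, MetaMultiset.inst, Function.update_of_ne hcd.symm]

theorem Calculus.IsContextSharingSemiAnalytic.analytic {H : Calculus L α}
    (h : H.IsContextSharingSemiAnalytic) : ∀ r ∈ H, r.Analytic := by
  intro r hr
  rcases h.1 r hr with h | (h | h | h | h) | h
  · intro M hM
    simp [h.1] at hM
  · obtain ⟨P, B, φ, l, h⟩ := h.isLeftForm
    exact h.analytic
  · exact h.analytic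
  · exact h.analytic
  · exact h.analytic
  · obtain ⟨P, B, φ, l, h⟩ := h.isLeftForm
    exact h.analytic

theorem Calculus.IsContextSharingSemiAnalytic.cases {H : Calculus L α}
    (h : H.IsContextSharingSemiAnalytic) {r : Rule L α} (hr : r ∈ H) {σ : ℕ → Formula L α}
    {τ : ℕ → Multiset (Formula L α)} (hA : r.Admits σ τ) :
    r.IsFocusedAxiom ∨ r.IsStepInstance H σ τ ∨ (r.IsModalK ∨ r.IsModalD) := by
  rcases h.1 r hr with h | (h | h | h | h) | h
  · exact Or.inl h
  · obtain ⟨P, B, φ, l, h⟩ := h.isLeftForm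
    exact Or.inr (Or.inl (h.isStepInstance hr hA))
  · exact Or.inr (Or.inl (h.isStepInstance hr hA))
  · exact Or.inr (Or.inr (Or.inl h))
  · exact Or.inr (Or.inr (Or.inr h))
  · obtain ⟨P, B, φ, l, h⟩ := h.isLeftForm
    exact Or.inr (Or.inl (h.isStepInstance hr hA))

/-- The only use of the proviso on `D`: even in the case of `D`, inequalities between values must be
boxed by `K`. -/
theorem Calculus.IsContextSharingSemiAnalytic.hasK {H : Calculus L α}
    (h : H.IsContextSharingSemiAnalytic) {r : Rule L α} (hr : r ∈ H)
    (hm : r.IsModalK ∨ r.IsModalD) {b : {c : L.Conn // L.arity c = 1}} (hb : b ∈ L.box) :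
    H.HasK b := by
  rcases hm with hm | hm
  · exact hm.hasK hr hb
  · obtain ⟨r', hr', hK⟩ := h.2 ⟨r, hr, hm⟩
    exact hK.hasK hr' hb

theorem Calculus.Derivable.single {H : Calculus L α} {S : Sequent L α} (h : H.Derivable S) :
    S.Single := by
  cases h with
  | step r hr σ τ h prem => exact h.1

theorem Calculus.IsStep.single {H : Calculus L α} {l : List ℕ} {R : Set (Row L α)}
    {mL mR : Multiset (Formula L α)} (hs : H.IsStep l R mL mR) (s : ℕ → Multiset (Formula L α))
    {Δ : Multiset (Formula L α)} (hΔ : (mR + Δ).card ≤ 1) {ρ : Row L α} (hρ : ρ ∈ R) :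
    (ρ.seq s Δ).Single := by
  obtain ⟨r, hr, σ, τ, hA, hc, hp⟩ := hs.inst s Δ hΔ
  obtain ⟨M, hM, h⟩ := (hp _).2 ⟨ρ, hρ, rfl⟩
  exact h ▸ hA.2 M hM

theorem Calculus.IsStep.split {H : Calculus L α} {l : List ℕ} {R : Set (Row L α)}
    {mL mR : Multiset (Formula L α)} (hs : H.IsStep l R mL mR) {τ : ℕ → Multiset (Formula L α)}
    {Γ₁ Γ₂ : Multiset (Formula L α)} (h : Γ₁ + Γ₂ = mL + (l.map τ).sum) :
    ∃ s g : ℕ → Multiset (Formula L α), (∀ c ∈ l, τ c = s c + g c) ∧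
      (Γ₁ = mL + (l.map s).sum ∧ Γ₂ = (l.map g).sum ∧ mR = 0 ∨
        Γ₁ = (l.map s).sum ∧ Γ₂ = mL + (l.map g).sum) := by
  obtain ⟨u, w, s', g', hm, hsum, rfl, rfl⟩ := exists_refinement h
  obtain ⟨s, g, hsg, rfl, rfl⟩ := exists_split_sum hs.nodup hsum.symm
  refine ⟨s, g, hsg, ?_⟩
  -- `u` is the share of `Γ₁` in `mL`. As `mL` has at most one member, `u` is empty or all of `mL`.
  rcases Multiset.empty_or_exists_mem u with rfl | ⟨a, ha⟩
  · right
    simp_all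
  · left
    rcases hs.main with ⟨φ, hφ, hR⟩ | ⟨φ, h0, -⟩
    · have hw : w = 0 := by
        have h₁ := congrArg Multiset.card (hm.symm.trans hφ)
        have h₂ := Multiset.card_pos_iff_exists_mem.2 ⟨a, ha⟩
        rw [Multiset.card_add, Multiset.card_singleton] at h₁
        exact Multiset.card_eq_zero.1 (by omega)
      simp_all
    · have : a ∈ mL := by rw [hm]; exact Multiset.mem_add.2 (Or.inl ha)
      simp [h0] at this

end Steps

/-! ### Sequents as inequalities, interpolants as extremal elements -/

namespace HeytingModel

variable {L : Signature.{u}} {α : Type v} {t : Translation L} {H : Calculus L α} {Q : Type w}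
  [HeytingAlgebra Q] (m : HeytingModel t H Q)

/-- The value of an antecedent. -/
def ant (Γ : Multiset (Formula L α)) : Q := (Γ.map m.val).inf

/-- The value of a succedent. -/
def suc (Δ : Multiset (Formula L α)) : Q := (Δ.map m.val).sup

@[simp] theorem ant_zero : m.ant 0 = ⊤ := rfl
@[simp] theorem suc_zero : m.suc 0 = ⊥ := rfl
@[simp] theorem ant_singleton (A : Formula L α) : m.ant {A} = m.val A := by simp [ant]
@[simp] theorem suc_singleton (A : Formula L α) : m.suc {A} = m.val A := by simp [suc]
theorem ant_add (Γ Γ' : Multiset (Formula L α)) : m.ant (Γ + Γ') = m.ant Γ ⊓ m.ant Γ' := by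
  simp [ant]

theorem le_ant {Γ : Multiset (Formula L α)} {a : Q} : a ≤ m.ant Γ ↔ ∀ A ∈ Γ, a ≤ m.val A := by
  simp [ant, Multiset.le_inf]

theorem ant_le {Γ : Multiset (Formula L α)} {A : Formula L α} (h : A ∈ Γ) :
    m.ant Γ ≤ m.val A := m.le_ant.1 le_rfl A h

theorem ant_anti {Γ Γ' : Multiset (Formula L α)} (h : Γ ≤ Γ') : m.ant Γ' ≤ m.ant Γ :=
  m.le_ant.2 fun _ hA => m.ant_le (Multiset.mem_of_le h hA)

theorem ant_sum_le {l : List ℕ} {s : ℕ → Multiset (Formula L α)} {c : ℕ} (hc : c ∈ l) :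
    m.ant (l.map s).sum ≤ m.ant (s c) := m.ant_anti (mem_sum_map hc)

theorem le_ant_sum {l : List ℕ} {s : ℕ → Multiset (Formula L α)} {a : Q}
    (h : ∀ c ∈ l, a ≤ m.ant (s c)) : a ≤ m.ant (l.map s).sum := by
  induction l with
  | nil => simp
  | cons c l ih =>
    rw [List.map_cons, List.sum_cons, ant_add]
    exact le_inf (h c (by simp)) (ih fun d hd => h d (by simp [hd]))

theorem derivable_iff_le {Γ Δ : Multiset (Formula L α)} (hΔ : Δ.card ≤ 1) :
    H.Derivable ⟨Γ, Δ⟩ ↔ m.ant Γ ≤ m.suc Δ := m.derivable_iff ⟨Γ, Δ⟩ hΔ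

theorem le_of_derivable {Γ Δ : Multiset (Formula L α)} (h : H.Derivable ⟨Γ, Δ⟩) :
    m.ant Γ ≤ m.suc Δ := (m.derivable_iff_le h.single).1 h

theorem val_unary_le {b : {c : L.Conn // L.arity c = 1}} (hK : H.HasK b)
    {Γ : Multiset (Formula L α)} {A : Formula L α} (h : m.ant Γ ≤ m.val A) :
    m.ant (Γ.map (Formula.unary b)) ≤ m.val (Formula.unary b A) := by
  have h' := (m.derivable_iff_le (Γ := Γ) (Δ := {A}) (by simp)).2 (by simpa using h)
  simpa using m.le_of_derivable (hK.derivable h')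

/-- A step is sound for the values, with an additional formula `C` in all antecedents. -/
theorem step_sound {l : List ℕ} {R : Set (Row L α)} {mL mR : Multiset (Formula L α)}
    (hs : H.IsStep l R mL mR) {s : ℕ → Multiset (Formula L α)} {Δ : Multiset (Formula L α)}
    (hΔ : (mR + Δ).card ≤ 1) (C : Formula L α)
    (h : ∀ ρ ∈ R, m.val C ⊓ (m.ant ρ.ant ⊓ m.ant (s ρ.ctx)) ≤ m.suc (ρ.suc.getD Δ)) :
    m.val C ⊓ m.ant (mL + (l.map s).sum) ≤ m.suc (mR + Δ) := by
  -- `C` is added to every context; its copies in the conclusion collapse because meet is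
  -- idempotent.
  have hd := hs.derivable (s := fun c => s c + {C}) hΔ fun ρ hρ => by
    refine (m.derivable_iff_le (hs.single (fun c => s c + {C}) hΔ hρ)).2 (le_trans (le_of_eq ?_) (h ρ hρ))
    simp only [ant_add, ant_singleton]
    ac_rfl
  refine le_trans ?_ (m.le_of_derivable hd)
  rw [ant_add, ant_add]
  refine le_inf (inf_le_right.trans inf_le_left) (m.le_ant_sum fun c hc => ?_)
  rw [ant_add, ant_singleton]
  exact le_inf ((inf_le_right.trans inf_le_right).trans (m.ant_sum_le hc)) inf_le_left

/-! ### Values of `p`-free formulas -/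

/-- The values of the `p`-free formulas. -/
def freeVals (p : α) : Set Q := m.val '' {φ | φ.Free p}

theorem free_binary {p : α} {f : Formula L (Fin 2)} {φ ψ : Formula L α} (hφ : φ.Free p)
    (hψ : ψ.Free p) : (f.subst ![φ, ψ]).Free p :=
  Formula.free_subst.2 fun a _ => by fin_cases a <;> assumption

theorem free_nullary {p : α} {f : Formula L (Fin 0)} :
    (f.subst (![] : Fin 0 → Formula L α)).Free p :=
  Formula.free_subst.2 fun a => a.elim0

theorem isHeytingSubalgebra_freeVals (p : α) : IsHeytingSubalgebra (m.freeVals p) where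
  top_mem := ⟨t.top, free_nullary, m.val_top⟩
  bot_mem := ⟨t.bot, free_nullary, m.val_bot⟩
  isSublattice := by
    constructor
    · rintro _ ⟨φ, hφ, rfl⟩ _ ⟨ψ, hψ, rfl⟩
      exact ⟨t.or φ ψ, free_binary hφ hψ, m.val_or _ _⟩
    · rintro _ ⟨φ, hφ, rfl⟩ _ ⟨ψ, hψ, rfl⟩
      exact ⟨t.and φ ψ, free_binary hφ hψ, m.val_and _ _⟩
  himp_mem := by
    rintro _ ⟨φ, hφ, rfl⟩ _ ⟨ψ, hψ, rfl⟩
    exact ⟨t.imp φ ψ, free_binary hφ hψ, m.val_imp _ _⟩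

variable {p : α}

theorem ant_mem_freeVals {Γ : Multiset (Formula L α)} (h : ∀ A ∈ Γ, A.Free p) :
    m.ant Γ ∈ m.freeVals p := by
  induction Γ using Multiset.induction_on with
  | empty => exact (m.isHeytingSubalgebra_freeVals p).top_mem
  | cons A Γ ih =>
    rw [← Multiset.singleton_add, ant_add, ant_singleton]
    exact (m.isHeytingSubalgebra_freeVals p).isSublattice.infClosed ⟨A, h A (by simp), rfl⟩
      (ih fun B hB => h B (by simp [hB]))

theorem suc_mem_freeVals {Δ : Multiset (Formula L α)} (h : ∀ A ∈ Δ, A.Free p) :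
    m.suc Δ ∈ m.freeVals p := by
  induction Δ using Multiset.induction_on with
  | empty => exact (m.isHeytingSubalgebra_freeVals p).bot_mem
  | cons A Δ ih =>
    rw [suc, Multiset.map_cons, Multiset.sup_cons]
    exact (m.isHeytingSubalgebra_freeVals p).isSublattice.supClosed ⟨A, h A (by simp), rfl⟩
      (ih fun B hB => h B (by simp [hB]))

/-- `A` is the weakest `p`-free formula that together with the antecedent of `S` implies the
succedent. -/
def IsPre (p : α) (S : Sequent L α) (A : Formula L α) : Prop :=
  A.Free p ∧ IsGreatest {f | f ∈ m.freeVals p ∧ f ⊓ m.ant S.ant ≤ m.suc S.suc} (m.val A)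

/-- `E` is the strongest `p`-free consequence of `Γ`. -/
def IsPost (p : α) (Γ : Multiset (Formula L α)) (E : Formula L α) : Prop :=
  E.Free p ∧ IsLeast {f | f ∈ m.freeVals p ∧ m.ant Γ ≤ f} (m.val E)

variable {m}

theorem IsPre.sound {S : Sequent L α} {A : Formula L α} (h : m.IsPre p S A) :
    m.val A ⊓ m.ant S.ant ≤ m.suc S.suc := h.2.1.2

theorem IsPre.ant_le {S : Sequent L α} {A : Formula L α} (h : m.IsPre p S A)
    {Γ : Multiset (Formula L α)} (hΓ : ∀ B ∈ Γ, B.Free p)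
    (hle : m.ant Γ ⊓ m.ant S.ant ≤ m.suc S.suc) : m.ant Γ ≤ m.val A :=
  h.2.2 ⟨m.ant_mem_freeVals hΓ, hle⟩

theorem IsPost.sound {Γ : Multiset (Formula L α)} {E : Formula L α} (h : m.IsPost p Γ E) :
    m.ant Γ ≤ m.val E := h.2.1.2

/-- By residuation, `Γ` moves to the right: the implication from `Γ` to `Δ` is a `p`-free value
above `Θ`. -/
theorem IsPost.inf_ant_le {Θ : Multiset (Formula L α)} {E : Formula L α} (h : m.IsPost p Θ E)
    {Γ Δ : Multiset (Formula L α)} (hΓ : ∀ B ∈ Γ, B.Free p) (hΔ : ∀ B ∈ Δ, B.Free p)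
    (hle : m.ant Θ ⊓ m.ant Γ ≤ m.suc Δ) : m.val E ⊓ m.ant Γ ≤ m.suc Δ :=
  le_himp_iff.1 (h.2.2 ⟨(m.isHeytingSubalgebra_freeVals p).himp_mem _ (m.ant_mem_freeVals hΓ) _
    (m.suc_mem_freeVals hΔ), le_himp_iff.2 hle⟩)

end HeytingModel

/-! ### Sequents below a sequent -/

section Lower

variable {L : Signature.{u}} {α : Type v}

/-- The sequents on which the interpolants of `S` depend. -/
def Calculus.lower (H : Calculus L α) (S : Sequent L α) : Set (Sequent L α) :=
  H.premisesOf S ∪ {S' | S'.IsProperSub S} ∪ ⋃ b ∈ {b | b ∈ L.box},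
    {S' | S'.ant.map (Formula.unary b) = S.ant ∧ S'.suc.map (Formula.unary b) = S.suc ∧
      S'.ant + S'.suc ≠ 0}

theorem finite_box (L : Signature.{u}) : {b | b ∈ L.box}.Finite :=
  Set.Subsingleton.finite fun _ ha _ hb => Option.mem_unique ha hb

theorem Calculus.finite_lower {H : Calculus L α} (hH : ∀ r ∈ H, r.Analytic)
    {S : Sequent L α} (hS : {r | r ∈ H ∧ r.BackwardApplicable S}.Finite) :
    (H.lower S).Finite := by
  classical
  refine ((H.finite_premisesOf hH hS).union ?_).union ((finite_box L).biUnion fun b _ => ?_)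
  · refine (Set.Finite.image2 Sequent.mk S.ant.powerset.toFinset.finite_toSet
      S.suc.powerset.toFinset.finite_toSet).subset fun S' h => ?_
    exact ⟨S'.ant, by simpa using h.1, S'.suc, by simpa using h.2.1, rfl⟩
  -- Boxing is injective, so `S` can be unboxed in at most one way.
  · refine Set.Subsingleton.finite ?_
    rintro S₁ ⟨h₁, h₂, -⟩ S₂ ⟨h₁', h₂', -⟩
    exact Sequent.ext (Multiset.map_injective (Formula.unary_injective b) (h₁.trans h₁'.symm))
      (Multiset.map_injective (Formula.unary_injective b) (h₂.trans h₂'.symm))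

theorem Calculus.single_of_mem_lower {H : Calculus L α} {S S' : Sequent L α} (hS : S.Single)
    (h : S' ∈ H.lower S) : S'.Single := by
  rcases h with (⟨r, hr, σ, τ, hA, hc, M, hM, rfl⟩ | h) | h
  · exact hA.2 M hM
  · exact (Multiset.card_le_card h.2.1).trans hS
  · obtain ⟨b, -, -, h, -⟩ := Set.mem_iUnion₂.1 h
    rwa [Sequent.Single, ← h, Multiset.card_map] at hS

end Lower

/-! ### Construction of the interpolants -/

namespace HeytingModel

variable {L : Signature.{u}} {α : Type v} {t : Translation L} {H : Calculus L α} {Q : Type w}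
  [HeytingAlgebra Q] (m : HeytingModel t H Q) {p : α}

/-- A finite sublattice with the data from which the interpolants of `S` are built. -/
structure IsBase (p : α) (S : Sequent L α) (M : Set Q) : Prop where
  lattice : IsFiniteBoundedSublattice M
  subset : M ⊆ m.freeVals p
  pre : ∀ S' ∈ H.lower S, ∃ A, m.IsPre p S' A ∧ m.val A ∈ M ∧
    ∀ b ∈ L.box, m.val (Formula.unary b A) ∈ M
  post : ∀ S' ∈ H.lower S, ∃ E, m.IsPost p S'.ant E ∧ m.val E ∈ M ∧
    ∀ b ∈ L.box, m.val (Formula.unary b E) ∈ M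
  free : ∀ B ∈ S.ant, B.Free p → m.val B ∈ M

/-- The interpolants serve the semi-analytic rules, their boxes the modal rules, and the `p`-free
members of the antecedent the axioms. -/
theorem exists_isBase {S : Sequent L α} (hfin : (H.lower S).Finite)
    (ih : ∀ S' ∈ H.lower S, (∃ A, m.IsPre p S' A) ∧ ∃ E, m.IsPost p S'.ant E) :
    ∃ M, m.IsBase p S M := by
  classical
  have hA : ∀ S', ∃ A, S' ∈ H.lower S → m.IsPre p S' A := fun S' => by
    by_cases h : S' ∈ H.lower S
    · obtain ⟨A, hA⟩ := (ih S' h).1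
      exact ⟨A, fun _ => hA⟩
    · exact ⟨t.top, fun h' => absurd h' h⟩
  have hE : ∀ S', ∃ E, S' ∈ H.lower S → m.IsPost p S'.ant E := fun S' => by
    by_cases h : S' ∈ H.lower S
    · obtain ⟨E, hE⟩ := (ih S' h).2
      exact ⟨E, fun _ => hE⟩
    · exact ⟨t.top, fun h' => absurd h' h⟩
  choose A hA using hA
  choose E hE using hE
  set W : Set (Formula L α) := A '' H.lower S ∪ E '' H.lower S with hW
  have hWfin : W.Finite := (hfin.image _).union (hfin.image _)
  have hWfree : ∀ φ ∈ W, φ.Free p := by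
    rintro φ (⟨S', h, rfl⟩ | ⟨S', h, rfl⟩)
    exacts [(hA S' h).1, (hE S' h).1]
  set W' : Set (Formula L α) := W ∪ (⋃ b ∈ {b | b ∈ L.box}, Formula.unary b '' W) ∪
    {B | B ∈ S.ant ∧ B.Free p} with hW'
  have hW'fin : W'.Finite := by
    refine (hWfin.union ((finite_box L).biUnion fun b _ => hWfin.image _)).union ?_
    exact S.ant.toFinset.finite_toSet.subset fun B hB => by simpa using hB.1
  have hW'free : ∀ φ ∈ W', φ.Free p := by
    rintro φ ((h | h) | h)
    · exact hWfree φ h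
    · obtain ⟨b, -, ψ, hψ, rfl⟩ := Set.mem_iUnion₂.1 h
      exact Formula.free_unary (hWfree ψ hψ)
    · exact h.2
  obtain ⟨M, hM, hUM, hMF⟩ := (m.isHeytingSubalgebra_freeVals p).exists_finite_sublattice
    (hW'fin.image m.val) (Set.image_mono hW'free)
  have h₁ : ∀ φ ∈ W, m.val φ ∈ M ∧ ∀ b ∈ L.box, m.val (Formula.unary b φ) ∈ M := fun φ hφ =>
    ⟨hUM ⟨φ, Or.inl (Or.inl hφ), rfl⟩,
      fun b hb => hUM ⟨_, Or.inl (Or.inr (Set.mem_biUnion hb ⟨φ, hφ, rfl⟩)), rfl⟩⟩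
  exact ⟨M, hM, hMF, fun S' h => ⟨A S', hA S' h, h₁ _ (Or.inl ⟨S', h, rfl⟩)⟩,
    fun S' h => ⟨E S', hE S' h, h₁ _ (Or.inr ⟨S', h, rfl⟩)⟩,
    fun B hB hBp => hUM ⟨B, Or.inr ⟨hB, hBp⟩, rfl⟩⟩

variable {m}

theorem exists_isPost {X : Multiset (Formula L α)} (hsa : H.IsContextSharingSemiAnalytic)
    {M : Set Q} (hM : m.IsBase p ⟨X, 0⟩ M) : ∃ E, m.IsPost p X E := by
  obtain ⟨e, ⟨E, hEp, rfl⟩, hXE, happ⟩ :=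
    hM.lattice.exists_upper_approx (m.isHeytingSubalgebra_freeVals p) hM.subset (m.ant X)
  have happ₁ : ∀ q ∈ M, m.ant X ≤ q → m.val E ≤ q := fun q hq h => by
    simpa using happ ⊤ hM.lattice.top_mem q hq (by simpa using h)
  have happ₀ : m.ant X ≤ ⊥ → ∀ q, m.val E ≤ q := fun h q =>
    (happ₁ ⊥ hM.lattice.bot_mem h).trans bot_le
  -- `Γ` and `Δ` must vary in the induction, as backward steps on `p`-free main formulas change
  -- them, while `X` stays fixed.
  suffices key : ∀ T, H.Derivable T → ∀ Γ Δ : Multiset (Formula L α), (∀ B ∈ Γ, B.Free p) →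
      (∀ B ∈ Δ, B.Free p) → T = ⟨X + Γ, Δ⟩ → m.val E ⊓ m.ant Γ ≤ m.suc Δ by
    refine ⟨E, hEp, ⟨⟨E, hEp, rfl⟩, hXE⟩, ?_⟩
    rintro _ ⟨⟨φ, hφ, rfl⟩, h⟩
    have hd : H.Derivable ⟨X, {φ}⟩ := (m.derivable_iff_le (by simp)).2 (by simpa using h)
    simpa using key _ hd 0 {φ} (by simp) (by simpa using hφ) (by simp)
  have hmem : ∀ {Γ : Multiset (Formula L α)} {B}, B.Free p → B ∈ X + Γ →
      m.val E ⊓ m.ant Γ ≤ m.val B := by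
    intro Γ B hB hBm
    rcases Multiset.mem_add.1 hBm with h | h
    · exact inf_le_left.trans (happ₁ _ (hM.free B h hB) (m.ant_le h))
    · exact inf_le_right.trans (m.ant_le h)
  intro T hT
  induction hT with
  | step r hr σ τ hA prem ih =>
  intro Γ Δ hΓ hΔ hT
  rcases hsa.cases hr hA with h | h | h
  · rcases h.cases hr hA p with ⟨B, hB⟩ | hd | ⟨N, hN, hNp, hd⟩
    · obtain ⟨h₁, rfl⟩ := Sequent.mk.inj (hB.symm.trans hT)
      rw [suc_singleton]
      exact hmem (hΔ B (by simp)) (by rw [← h₁]; simp)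
    · rw [hT] at hd
      exact le_top.trans (m.le_of_derivable hd)
    · rw [hT] at hN
      have hN0 := m.le_of_derivable hd
      rcases hNp with hNp | hNp
      · refine (m.le_ant.2 fun B hB => ?_).trans (hN0.trans bot_le)
        exact hmem (hNp B hB) (Multiset.mem_of_le hN hB)
      · refine inf_le_left.trans (happ₀ (le_trans (m.le_ant.2 fun B hB => m.ant_le ?_) hN0) _)
        exact (Multiset.mem_add.1 (Multiset.mem_of_le hN hB)).resolve_right
          fun h => hNp B hB (hΓ B h)
  · obtain ⟨l, R, mL, mR, Δ', hs, hcard, hc, hp⟩ := h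
    obtain ⟨h₁, rfl⟩ := Sequent.mk.inj (hT.symm.trans hc)
    obtain ⟨s, g, hsg, ⟨hX, rfl, rfl⟩ | ⟨hX, rfl⟩⟩ := hs.split h₁
    · simp only [zero_add] at hΔ hcard ⊢
      have hgΓ : ∀ {ρ}, ρ ∈ R → m.ant (l.map g).sum ≤ m.ant (g ρ.ctx) := fun hρ =>
        m.ant_sum_le (hs.ctx_mem _ hρ)
      have hgp : ∀ {ρ}, ρ ∈ R → ∀ B ∈ g ρ.ctx, B.Free p := fun hρ B hB =>
        hΓ B (Multiset.mem_of_le (mem_sum_map (hs.ctx_mem _ hρ)) hB)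
      -- The main formula is in `X`. In place of `Γ` and `Δ` only two elements of `M` are used: `c`,
      -- the least above `Γ`, lies below the left interpolants of the closed premises, and `o`, the
      -- greatest below `Γ ⇨ Δ`, lies above the right interpolants of the open ones.
      obtain ⟨c, ⟨hcM, hcΓ⟩, hcl⟩ := hM.lattice.exists_isLeast (m.ant (l.map g).sum)
      obtain ⟨o, ⟨hoM, hoΓ⟩, hog⟩ :=
        hM.lattice.exists_isGreatest (m.ant (l.map g).sum ⇨ m.suc Δ')
      obtain ⟨C, -, rfl⟩ := hM.subset hcM
      obtain ⟨O, -, rfl⟩ := hM.subset hoM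
      have hsound : m.val C ⊓ m.ant (mL + (l.map s).sum) ≤ m.suc (0 + {O}) := by
        refine m.step_sound hs (by simp) C fun ρ hρ => ?_
        have hlow : ρ.seq s 0 ∈ H.lower ⟨X, 0⟩ := by
          have := hs.seq_mem_premisesOf (s := s) (Δ := 0) (by simp) hρ
          rw [← hX, zero_add] at this
          exact Or.inl (Or.inl this)
        obtain ⟨N, hN, hNeq⟩ := hp ρ hρ
        have hprem := m.le_of_derivable (hNeq ▸ prem N hN)
        rw [hsg _ (hs.ctx_mem _ hρ), ant_add, ant_add] at hprem
        rcases hY : ρ.suc with _ | Y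
        · obtain ⟨E', hE', hE'M, -⟩ := hM.post _ hlow
          rw [hY] at hprem
          have : m.val E' ⊓ m.ant (g ρ.ctx) ≤ m.suc Δ' :=
            hE'.inf_ant_le (hgp hρ) hΔ (by simpa [Row.seq, ant_add, inf_assoc] using hprem)
          have hle : m.val E' ≤ m.val O :=
            hog ⟨hE'M, le_himp_iff.2 ((inf_le_inf_left _ (hgΓ hρ)).trans this)⟩
          refine (inf_le_right.trans ?_).trans (hle.trans (le_of_eq (by simp)))
          simpa [Row.seq, ant_add] using hE'.sound
        · obtain ⟨A', hA', hA'M, -⟩ := hM.pre _ hlow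
          rw [hY] at hprem
          have : m.ant (g ρ.ctx) ≤ m.val A' := hA'.ant_le (hgp hρ) (by
            simp only [Row.seq, hY, ant_add]
            exact le_trans (le_of_eq (by ac_rfl)) hprem)
          have hle : m.val C ≤ m.val A' := hcl ⟨hA'M, (hgΓ hρ).trans this⟩
          refine (inf_le_inf_right _ hle).trans ?_
          simpa [Row.seq, ant_add, hY] using hA'.sound
      rw [← hX, zero_add, suc_singleton, inf_comm] at hsound
      -- Now `X ⊓ c ≤ o` is one of the inequalities over `M` that `E` inherits from `X`.
      have h₂ := happ _ hcM _ hoM hsound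
      exact (le_inf ((inf_le_inf_left _ hcΓ).trans h₂) inf_le_right).trans
        (le_himp_iff.1 hoΓ)
    -- The main formula is `p`-free, hence so are the side formulas, and the same rule can be
    -- applied with `E` replacing the share of `X` in each context.
    · have hfree := hs.free p (fun B hB => hΓ B (Multiset.mem_add.2 (Or.inl hB)))
        fun B hB => hΔ B (Multiset.mem_add.2 (Or.inl hB))
      refine m.step_sound hs hcard E fun ρ hρ => ?_
      obtain ⟨N, hN, hNeq⟩ := hp ρ hρ
      have hctx := hsg _ (hs.ctx_mem _ hρ)
      have hgp : ∀ B ∈ g ρ.ctx + ρ.ant, B.Free p := fun B hB => by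
        rcases Multiset.mem_add.1 hB with h | h
        · exact hΓ B (Multiset.mem_add.2
            (Or.inr (Multiset.mem_of_le (mem_sum_map (hs.ctx_mem _ hρ)) h)))
        · exact (hfree ρ hρ).1 B h
      have hYp : ∀ B ∈ ρ.suc.getD Δ', B.Free p := by
        rcases hY : ρ.suc with _ | Y
        · exact fun B hB => hΔ B (Multiset.mem_add.2 (Or.inr hB))
        · exact (hfree ρ hρ).2 Y hY
      have hle : s ρ.ctx ≤ X := hX ▸ mem_sum_map (hs.ctx_mem _ hρ)
      have key : m.val E ⊓ m.ant (g ρ.ctx + ρ.ant) ≤ m.suc (ρ.suc.getD Δ') := by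
        by_cases hsX : s ρ.ctx = X
        · refine ih N hN _ _ hgp hYp ?_
          rw [hNeq, Row.seq, hctx, hsX]
          congr 1
          rw [add_comm, add_assoc]
        · have hlow : (⟨s ρ.ctx, 0⟩ : Sequent L α) ∈ H.lower ⟨X, 0⟩ :=
            Or.inl (Or.inr ⟨hle, le_rfl, fun h => hsX (Sequent.mk.inj h).1⟩)
          obtain ⟨E', hE', hE'M, -⟩ := hM.post _ hlow
          have hEE' : m.val E ≤ m.val E' := happ₁ _ hE'M ((m.ant_anti hle).trans hE'.sound)
          refine (inf_le_inf_right _ hEE').trans (hE'.inf_ant_le hgp hYp ?_)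
          have hprem := m.le_of_derivable (hNeq ▸ prem N hN)
          rw [hctx] at hprem
          refine le_trans (le_of_eq ?_) hprem
          simp only [ant_add]
          ac_rfl
      refine le_trans (le_of_eq ?_) key
      simp only [ant_add]
      ac_rfl
  · have hd := Calculus.Derivable.step r hr σ τ hA prem
    rw [hT] at hd
    obtain ⟨b, hb, Θ, Δ', hbox, N, hN, hNeq, hc⟩ :=
      r.exists_modal_inst hr h σ τ fun b hb => hsa.hasK hr h hb
    have hK := hsa.hasK hr h hb
    obtain ⟨h₁, rfl⟩ := Sequent.mk.inj (hT.symm.trans hc)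
    obtain ⟨Θ₁, Θ₂, rfl, rfl, rfl⟩ := exists_of_map_eq_add h₁.symm
    -- If `X` is empty, unboxing gives no smaller sequent, but then the given derivation is already
    -- the claim.
    by_cases h0 : Θ₁ = 0
    · subst h0
      refine inf_le_right.trans ?_
      simpa using m.le_of_derivable hd
    · have hlow : (⟨Θ₁, 0⟩ : Sequent L α) ∈ H.lower ⟨Θ₁.map (Formula.unary b), 0⟩ :=
        Or.inr (Set.mem_biUnion hb ⟨rfl, rfl, by simpa using h0⟩)
      obtain ⟨E', hE', -, hE'M⟩ := hM.post _ hlow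
      have hprem := m.le_of_derivable (hNeq ▸ prem N hN)
      rw [ant_add] at hprem
      have h₂ : m.val E' ⊓ m.ant Θ₂ ≤ m.suc Δ' := hE'.inf_ant_le
        (fun B hB => Formula.free_of_unary (hΓ _ (Multiset.mem_map_of_mem _ hB)))
        (fun B hB => Formula.free_of_unary (hΔ _ (Multiset.mem_map_of_mem _ hB))) hprem
      have hΔ' : Δ'.card ≤ 1 := by simpa [Sequent.Single] using hd.single
      have h₃ := m.le_of_derivable (hbox ({E'} + Θ₂)
        ((m.derivable_iff_le hΔ').2 (by rwa [ant_add, ant_singleton])))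
      rw [Multiset.map_add, ant_add, Multiset.map_singleton, ant_singleton] at h₃
      exact (inf_le_inf_right _ (happ₁ _ (hE'M b hb) (m.val_unary_le hK hE'.sound))).trans h₃

/-- The interpolant is `E ⇨ a`. It is sound because the antecedent lies below `E`, so maximality may
be tested with `E` as an extra assumption. -/
theorem exists_isPre_of_isPost {S : Sequent L α} {E : Formula L α} (hE : m.IsPost p S.ant E)
    {a : Q} (ha : a ∈ m.freeVals p) (hsound : a ⊓ m.ant S.ant ≤ m.suc S.suc)
    (h : ∀ φ : Formula L α, φ.Free p → m.val φ ⊓ m.ant S.ant ≤ m.suc S.suc →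
      m.val E ⊓ m.val φ ≤ a) : ∃ A, m.IsPre p S A := by
  obtain ⟨A, hA, hAa⟩ := (m.isHeytingSubalgebra_freeVals p).himp_mem _ hE.2.1.1 _ ha
  refine ⟨A, hA, ⟨⟨A, hA, rfl⟩, ?_⟩, ?_⟩
  · rw [hAa]
    exact (le_inf ((inf_le_inf_left _ hE.sound).trans himp_inf_le) inf_le_right).trans hsound
  · rintro _ ⟨⟨φ, hφ, rfl⟩, hle⟩
    rw [hAa, le_himp_iff, inf_comm]
    exact h φ hφ hle

/-- The best bound `a` inside `M` does not suffice: `p`-free consequences of `X` may be needed to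
make use of `Γ`, and `E` supplies them. -/
theorem exists_isPre {X : Multiset (Formula L α)} {B : Formula L α} (hB : ¬ B.Free p)
    (hsa : H.IsContextSharingSemiAnalytic) {M : Set Q} (hM : m.IsBase p ⟨X, {B}⟩ M)
    {E : Formula L α} (hE : m.IsPost p X E) : ∃ A, m.IsPre p ⟨X, {B}⟩ A := by
  obtain ⟨a, ⟨haM, haX⟩, hag⟩ := hM.lattice.exists_isGreatest (m.ant X ⇨ m.val B)
  obtain ⟨A, hAp, rfl⟩ := hM.subset haM
  rw [le_himp_iff] at haX
  have happ : ∀ q ∈ M, q ⊓ m.ant X ≤ m.val B → q ≤ m.val A := fun q hq h =>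
    hag ⟨hq, le_himp_iff.2 h⟩
  have happ₀ : m.ant X ≤ m.val B → ∀ q, q ≤ m.val A := fun h q =>
    le_top.trans (happ ⊤ hM.lattice.top_mem (inf_le_right.trans h))
  suffices key : ∀ T, H.Derivable T → ∀ Γ : Multiset (Formula L α), (∀ C ∈ Γ, C.Free p) →
      T = ⟨X + Γ, {B}⟩ → m.val E ⊓ m.ant Γ ≤ m.val A by
    refine exists_isPre_of_isPost hE ⟨A, hAp, rfl⟩ (by simpa using haX) fun φ hφ hle => ?_
    have hd : H.Derivable ⟨X + {φ}, {B}⟩ := (m.derivable_iff_le (by simp)).2 (by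
      rwa [ant_add, ant_singleton, inf_comm])
    simpa using key _ hd {φ} (by simpa using hφ) rfl
  intro T hT
  induction hT with
  | step r hr σ τ hA prem ih =>
  intro Γ hΓ hT
  rcases hsa.cases hr hA with h | h | h
  · rcases h.cases hr hA p with ⟨C, hC⟩ | hd | ⟨N, hN, hNp, hd⟩
    · obtain ⟨h₁, h₂⟩ := Sequent.mk.inj (hC.symm.trans hT)
      obtain rfl := Multiset.singleton_inj.1 h₂
      have hC : C ∈ X + Γ := by rw [← h₁]; simp
      exact happ₀ (m.ant_le ((Multiset.mem_add.1 hC).resolve_right fun h => hB (hΓ C h))) _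
    · rw [hT] at hd
      exact happ₀ (le_top.trans (by simpa using m.le_of_derivable hd)) _
    · rw [hT] at hN
      have hN0 := m.le_of_derivable hd
      rcases hNp with hNp | hNp
      · have : m.ant X ⊓ m.ant Γ ≤ m.suc 0 := by
          rw [← ant_add]
          exact (m.ant_anti hN).trans hN0
        exact (hE.inf_ant_le hΓ (by simp) this).trans bot_le
      · refine happ₀ (le_trans (m.le_ant.2 fun C hC => m.ant_le ?_) (hN0.trans bot_le)) _
        exact (Multiset.mem_add.1 (Multiset.mem_of_le hN hC)).resolve_right
          fun h => hNp C hC (hΓ C h)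
  · obtain ⟨l, R, mL, mR, Δ, hs, hcard, hc, hp⟩ := h
    obtain ⟨h₁, hBΔ⟩ := Sequent.mk.inj (hT.symm.trans hc)
    obtain ⟨s, g, hsg, hsplit⟩ := hs.split h₁
    have hgp : (l.map g).sum ≤ Γ → ∀ {ρ}, ρ ∈ R → ∀ C ∈ g ρ.ctx, C.Free p := fun hle ρ hρ C hC =>
      hΓ C (Multiset.mem_of_le ((mem_sum_map (hs.ctx_mem _ hρ)).trans hle) hC)
    -- The main formula of a right rule is `B`, so this case joins the one with the main formula in
    -- `X`.
    have hcases : (X = mL + (l.map s).sum ∧ Γ = (l.map g).sum) ∨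
        (X = (l.map s).sum ∧ Γ = mL + (l.map g).sum ∧ mR = 0) := by
      rcases hsplit with h | ⟨hX, h⟩
      · exact Or.inl ⟨h.1, h.2.1⟩
      · rcases hs.main with ⟨φ, hφ, h0⟩ | ⟨φ, h0, hφ⟩
        · exact Or.inr ⟨hX, h, h0⟩
        · exact Or.inl ⟨by rw [h0, zero_add, hX], by rw [h, h0, zero_add]⟩
    rcases hcases with ⟨hX, rfl⟩ | ⟨hX, rfl, rfl⟩
    · obtain ⟨c, ⟨hcM, hcΓ⟩, hcl⟩ := hM.lattice.exists_isLeast (m.ant (l.map g).sum)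
      obtain ⟨C, -, rfl⟩ := hM.subset hcM
      refine inf_le_right.trans (hcΓ.trans (happ _ hcM ?_))
      rw [hX, ← m.suc_singleton B, hBΔ]
      refine m.step_sound hs hcard C fun ρ hρ => ?_
      have hlow : ρ.seq s Δ ∈ H.lower ⟨X, {B}⟩ := by
        rw [hX, hBΔ]
        exact Or.inl (Or.inl (hs.seq_mem_premisesOf hcard hρ))
      obtain ⟨A', hA', hA'M, -⟩ := hM.pre _ hlow
      obtain ⟨N, hN, hNeq⟩ := hp ρ hρ
      have hprem := m.le_of_derivable (hNeq ▸ prem N hN)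
      rw [hsg _ (hs.ctx_mem _ hρ), ant_add, ant_add] at hprem
      have : m.ant (g ρ.ctx) ≤ m.val A' := hA'.ant_le (hgp le_rfl hρ) (by
        simp only [Row.seq, ant_add]
        exact le_trans (le_of_eq (by ac_rfl)) hprem)
      have hle : m.val C ≤ m.val A' := hcl ⟨hA'M, (m.ant_sum_le (hs.ctx_mem _ hρ)).trans this⟩
      refine (inf_le_inf_right _ hle).trans ?_
      simpa [Row.seq, ant_add] using hA'.sound
    · have hfree := hs.free p (fun C hC => hΓ C (Multiset.mem_add.2 (Or.inl hC))) (by simp)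
      simp only [zero_add] at hBΔ
      subst hBΔ
      -- The same left rule is applied with `A` as its succedent instead of `B`, and with `E` in its
      -- contexts.
      have hgoal : m.val E ⊓ m.ant (mL + (l.map g).sum) ≤ m.suc (0 + {A}) := by
        refine m.step_sound hs (by simp) E fun ρ hρ => ?_
        obtain ⟨N, hN, hNeq⟩ := hp ρ hρ
        have hctx := hsg _ (hs.ctx_mem _ hρ)
        have hfr : ∀ C ∈ g ρ.ctx + ρ.ant, C.Free p := fun C hC =>
          (Multiset.mem_add.1 hC).elim (hgp (Multiset.le_add_left _ _) hρ C) ((hfree ρ hρ).1 C)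
        have hle : s ρ.ctx ≤ X := hX ▸ mem_sum_map (hs.ctx_mem _ hρ)
        have hprem := m.le_of_derivable (hNeq ▸ prem N hN)
        rw [hctx] at hprem
        have key : m.val E ⊓ m.ant (g ρ.ctx + ρ.ant) ≤ m.suc (ρ.suc.getD {A}) := by
          rcases hY : ρ.suc with _ | Y
          · rw [Option.getD_none, suc_singleton]
            by_cases hsX : s ρ.ctx = X
            · refine ih N hN _ hfr ?_
              rw [hNeq, Row.seq, hctx, hsX, hY]
              congr 1
              rw [add_comm, add_assoc]
            · have hlow : (⟨s ρ.ctx, {B}⟩ : Sequent L α) ∈ H.lower ⟨X, {B}⟩ :=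
                Or.inl (Or.inr ⟨hle, le_rfl, fun h => hsX (Sequent.mk.inj h).1⟩)
              obtain ⟨A', hA', hA'M, -⟩ := hM.pre _ hlow
              have h₂ : m.ant (g ρ.ctx + ρ.ant) ≤ m.val A' := hA'.ant_le hfr (by
                rw [hY] at hprem
                refine le_trans (le_of_eq ?_) hprem
                simp only [ant_add]
                ac_rfl)
              refine inf_le_right.trans (h₂.trans (happ _ hA'M ?_))
              exact (inf_le_inf_left _ (m.ant_anti hle)).trans (by simpa using hA'.sound)
          -- A closed premise has a `p`-free succedent, about which `A` says nothing; here the right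
          -- interpolant of the whole of `X` is used.
          · refine hE.inf_ant_le hfr ((hfree ρ hρ).2 Y hY) ?_
            rw [hY] at hprem
            refine (inf_le_inf_right _ (m.ant_anti hle)).trans (le_trans (le_of_eq ?_) hprem)
            simp only [ant_add]
            ac_rfl
        refine le_trans (le_of_eq ?_) key
        simp only [ant_add]
        ac_rfl
      simpa using hgoal
  · obtain ⟨b, hb, Θ, Δ, hbox, N, hN, hNeq, hc⟩ :=
      r.exists_modal_inst hr h σ τ fun b hb => hsa.hasK hr h hb
    have hK := hsa.hasK hr h hb
    obtain ⟨h₁, h₂⟩ := Sequent.mk.inj (hT.symm.trans hc)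
    obtain ⟨Θ₁, Θ₂, rfl, rfl, rfl⟩ := exists_of_map_eq_add h₁.symm
    -- The succedent `B` is boxed, so the unboxed sequent is nonempty and smaller even when `X` is
    -- empty.
    have hΔ : Δ.card = 1 := by simpa using (congrArg Multiset.card h₂).symm
    have hlow : (⟨Θ₁, Δ⟩ : Sequent L α) ∈ H.lower ⟨Θ₁.map (Formula.unary b), {B}⟩ := by
      refine Or.inr (Set.mem_biUnion hb ⟨rfl, h₂.symm, fun h0 => ?_⟩)
      replace h0 : Θ₁ + Δ = 0 := h0
      simp [(add_eq_zero.1 h0).2] at hΔ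
    obtain ⟨A', hA', -, hA'M⟩ := hM.pre _ hlow
    have hprem := m.le_of_derivable (hNeq ▸ prem N hN)
    rw [ant_add, inf_comm] at hprem
    have h₃ : m.ant Θ₂ ≤ m.val A' := hA'.ant_le
      (fun B hB => Formula.free_of_unary (hΓ _ (Multiset.mem_map_of_mem _ hB))) hprem
    refine inf_le_right.trans ((m.val_unary_le hK h₃).trans (happ _ (hA'M b hb) ?_))
    have h₄ := m.le_of_derivable (hbox ({A'} + Θ₁)
      ((m.derivable_iff_le hΔ.le).2 (by rw [ant_add, ant_singleton]; exact hA'.sound)))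
    rwa [Multiset.map_add, ant_add, Multiset.map_singleton, ant_singleton, ← h₂,
      suc_singleton] at h₄

theorem exists_interpolants (m : HeytingModel t H Q) (hterm : H.Terminating) (hsa : H.IsContextSharingSemiAnalytic)
    (p : α) (S : Sequent L α) (hS : S.Single) :
    (∃ A, m.IsPre p S A) ∧ ∃ E, m.IsPost p S.ant E := by
  obtain ⟨hfin, lt, hwf, htrans, hprem, hsub, hbox⟩ := hterm
  have hlt : ∀ {S S' : Sequent L α}, S.Single → S' ∈ H.lower S → lt S' S := by
    intro S S' hS h
    rcases h with (⟨r, hr, σ, τ, hA, rfl, M, hM, rfl⟩ | h) | h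
    · exact hprem r hr σ τ hA M hM
    · exact hsub S S' hS h
    · obtain ⟨b, hb, h₁, h₂, h₃⟩ := Set.mem_iUnion₂.1 h
      have hcard : (0 + S'.suc).card ≤ 1 := by
        rwa [Sequent.Single, ← h₂, Multiset.card_map, ← zero_add S'.suc] at hS
      simpa [h₁, h₂] using hbox b hb 0 S'.ant 0 S'.suc h₃ hcard
  induction S using hwf.induction with
  | _ S ih =>
  -- The right interpolant is built at the sequent with the succedent of `S` deleted, which is `S`
  -- or a proper subsequent of it; in both cases the sequents it depends on lie below `S`.
  have hbase : ∀ S', S'.Single → (S' = S ∨ lt S' S) → ∃ M, m.IsBase p S' M := fun S' hS' hle => by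
    refine m.exists_isBase (Calculus.finite_lower hsa.analytic (hfin S' hS')) fun S'' h => ?_
    have h' := hlt hS' h
    refine ih S'' ?_ (Calculus.single_of_mem_lower hS' h)
    rcases hle with rfl | hle
    exacts [h', htrans _ _ _ h' hle]
  have hpost : ∃ E, m.IsPost p S.ant E := by
    obtain ⟨M, hM⟩ := hbase ⟨S.ant, 0⟩ (by simp [Sequent.Single]) (by
      by_cases h : S.suc = 0
      · exact Or.inl (Sequent.ext rfl h.symm)
      · exact Or.inr (hsub _ _ hS ⟨le_rfl, Multiset.zero_le _,
          fun h' => h (congrArg Sequent.suc h').symm⟩))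
    exact exists_isPost hsa hM
  refine ⟨?_, hpost⟩
  obtain ⟨E, hE⟩ := hpost
  by_cases hfree : ∀ B ∈ S.suc, B.Free p
  -- A `p`-free succedent is itself the bound `a`.
  · refine exists_isPre_of_isPost hE (m.suc_mem_freeVals hfree) inf_le_left fun φ hφ hle => ?_
    rw [inf_comm] at hle
    simpa using hE.inf_ant_le (Γ := {φ}) (by simpa using hφ) hfree (by simpa using hle)
  · obtain ⟨X, Y⟩ := S
    push Not at hfree
    obtain ⟨B, hBY, hB⟩ := hfree
    obtain rfl : Y = {B} := by
      obtain ⟨C, rfl⟩ := Multiset.card_eq_one.1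
        (le_antisymm hS (Multiset.card_pos_iff_exists_mem.2 ⟨B, hBY⟩))
      rw [Multiset.mem_singleton.1 hBY]
    obtain ⟨M, hM⟩ := hbase _ hS (Or.inl rfl)
    exact exists_isPre hB hsa hM hE

theorem hasWeakUniformInterpolation (m : HeytingModel t H Q) (hterm : H.Terminating)
    (hsa : H.IsContextSharingSemiAnalytic) : H.HasWeakUniformInterpolation H := by
  intro p
  have hI : ∀ S : Sequent L α, ∃ A, S.Single → m.IsPre p S A := fun S => by
    by_cases hS : S.Single
    · obtain ⟨A, hA⟩ := (m.exists_interpolants hterm hsa p S hS).1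
      exact ⟨A, fun _ => hA⟩
    · exact ⟨t.top, fun h => absurd h hS⟩
  have hJ : ∀ Γ : Multiset (Formula L α), ∃ E, m.IsPost p Γ E := fun Γ =>
    (m.exists_interpolants hterm hsa p ⟨Γ, 0⟩ (by simp [Sequent.Single])).2
  choose I hI using hI
  choose J hJ using hJ
  refine ⟨I, J, fun S hS => ⟨(hI S hS).1, ?_, fun Γ hΓ hd => ?_⟩,
    fun Γ => ⟨(hJ Γ).1, ?_, fun Γ' Δ hΓ hΔ hd => ?_⟩⟩
  · refine (m.derivable_iff_le (by simpa [Sequent.Single] using hS)).2 ?_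
    rw [ant_add, ant_singleton, add_zero, inf_comm]
    exact (hI S hS).sound
  · refine (m.derivable_iff_le (by simp)).2 ?_
    have h := m.le_of_derivable hd
    rw [ant_add, add_zero, inf_comm] at h
    rw [← Multiset.singleton_add, ant_add, suc_singleton]
    -- The left interpolant is above `Γ` even without `J`, which is added by weakening.
    exact inf_le_right.trans ((hI S hS).ant_le hΓ h)
  · exact (m.derivable_iff_le (by simp)).2 (by simpa using (hJ Γ).sound)
  · have h := m.le_of_derivable hd
    rw [ant_add] at h
    refine (m.derivable_iff_le hd.single).2 ?_
    rw [← Multiset.singleton_add, ant_add, ant_singleton]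
    exact (hJ Γ).inf_ant_le hΓ hΔ h

end HeytingModel

/-- The two quantifiers are the left interpolant of `⇒ φ` and the right interpolant of `φ ⇒`, taken
in the Lindenbaum algebra, where the order is provable implication. -/
theorem SuperIntLogic.hasUniformInterpolation {L : Signature.{u}} {α : Type v}
    {t : Translation L} (Λ : SuperIntLogic t α) {H : Calculus L α}
    (hH : H.IsCalculusFor Λ.logic) (hterm : H.Terminating)
    (hsa : H.IsContextSharingSemiAnalytic) : Λ.logic.HasUniformInterpolation := by
  intro φ p
  obtain ⟨A, hA⟩ := ((Λ.model hH).exists_interpolants hterm hsa p ⟨0, {φ}⟩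
    (by simp [Sequent.Single])).1
  obtain ⟨E, hE⟩ := ((Λ.model hH).exists_interpolants hterm hsa p ⟨{φ}, 0⟩
    (by simp [Sequent.Single])).2
  refine ⟨A, E, hA.1, hE.1, ?_, fun ψ hψ h => ?_, ?_, fun ψ hψ h => ?_⟩
  · have h := hA.sound
    simp only [HeytingModel.ant_zero, inf_top_eq, HeytingModel.suc_singleton] at h
    exact h
  · exact hA.2.2 ⟨⟨ψ, hψ, rfl⟩, by
      simp only [HeytingModel.ant_zero, inf_top_eq, HeytingModel.suc_singleton]
      exact h⟩
  · have h := hE.sound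
    simp only [HeytingModel.ant_singleton] at h
    exact h
  · exact hE.2.2 ⟨⟨ψ, hψ, rfl⟩, by
      simp only [HeytingModel.ant_singleton]
      exact h⟩

end SemiAnalytic

theorem mainTheorem3 {L : SemiAnalytic.Signature} {α : Type*} (t : SemiAnalytic.Translation L)
    (Λ : SemiAnalytic.Logic t α) (hIPC : SemiAnalytic.IPC t α ⊆ Λ.thms)
    (H : SemiAnalytic.Calculus L α) (hH : H.IsCalculusFor Λ)
    (hterm : H.Terminating) (hsa : H.IsContextSharingSemiAnalytic) :
    H.HasWeakUniformInterpolation H ∧ Λ.HasUniformInterpolation :=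
  let Λ' : SemiAnalytic.SuperIntLogic t α := ⟨Λ, hIPC⟩
  ⟨(Λ'.model hH).hasWeakUniformInterpolation hterm hsa, Λ'.hasUniformInterpolation hH hterm hsa⟩
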